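/- Let $M$ be a compact, connected, Hausdorff, second-countable smooth manifold (without boundary) of dimension $q$, let $\phi\in\mathrm{Diff}^2(M)$ have finitely many periodic orbits, and let $F:\mathbb{R}^N\times\mathbb{R}\to\mathbb{R}^N$, $F(x,z)=Ax+Cz$, with $A\in\mathbb{R}^{N\times N}$, $C\in\mathbb{R}^N$, $N\ge 2q$ and spectral radius $\rho(A)<1$. For $\omega\in C^2(M,\mathbb{R})$, the generalized synchronization $f_{(\phi,\omega,F)}:M\to\mathbb{R}^N$ is the map such that, for every $m\in M$, the sequence $x_t=f_{(\phi,\omega,F)}(\phi^t(m))$, $t\in\mathbb{Z}$, is the unique bounded solution of $x_t=F(x_{t-1},\omega(\phi^t(m)))$, $t\in\mathbb{Z}$; explicitly, $f_{(\phi,\omega,F)}(m)=\sum_{j\ge0}A^jC\,\omega(\phi^{-j}(m))$. Suppose that $f_{(\phi,\omega,F)}\in C^2(M,\mathbb{R}^N)$ for every $\omega\in C^2(M,\mathbb{R})$ and that the map $\Theta:C^2(M,\mathbb{R})\to C^2(M,\mathbb{R}^N)$, $\omega\mapsto f_{(\phi,\omega,F)}$, is continuous for the $C^2$ topologies. Suppose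 also that the two following conditions hold. (i) For each periodic point $m$ of $\phi$, with least period $n$, the derivative $T_m\phi^{-n}:T_mM\to T_mM$ has $q$ distinct (complex) eigenvalues. If $\lambda_{\max}$ is an eigenvalue of highest absolute value among the eigenvalues of all these linear maps and $n_{\min}$ is the smallest period of the periodic points of $\phi$, then $\rho(\lambda_{\max}A^{n_{\min}})<1$. (This condition is void if there are no such eigenvalues.) For each periodic point $m$ with least period $n$, the $q$ vectors $$(\mathbb{I}-\lambda_jA^n)^{-1}(\mathbb{I}-A)^{-1}(\mathbb{I}-A^n)C\in\mathbb{C}^N,\qquad \lambda_1,\dots,\lambda_q \text{ the eigenvalues of } T_m\phi^{-n},$$ are linearly independent over $\mathbb{C}$. (ii) The vectors $C,AC,\dots,A^{N-1}C$ are linearly independent. Then, for generic $\omega\in C^2(M,\mathbb{R})$, the generalized synchronization $f_{(\phi,\omega,F)}$ is an immersion; that is, the set of all $\omega\in C^2(M,\mathbb{R})$ for which the tangent map $T_mf_{(\phi,\omega,F)}$ is injective at every $m\in M$ is open and dense in $C^2(M,\mathbb{R})$ for the $C^2$ topology. -/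

import Mathlib

open scoped Manifold ContDiff

/-- The `C^n` topology on the space `C^n(M, V)` of `C^n` maps from a manifold `M` to a normed space
`V`: the coarsest topology for which, for every chart `ψ` of the maximal atlas and every `k ≤ n`,
the `k`-th derivative of the local representative `f ∘ ψ⁻¹` depends continuously on `f` with respect
to uniform convergence on the compact subsets of the target of `ψ`. For compact `M` and finite `n`
this is the Banach space topology of `C^n(M, V)`. -/
noncomputable instance ContMDiffMap.compactOpenCr {q : ℕ} {M : Type*} [TopologicalSpace M]
    [ChartedSpace (EuclideanSpace ℝ (Fin q)) M] {V : Type*} [NormedAddCommGroup V]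
    [NormedSpace ℝ V] {n : ℕ∞ω} :
    TopologicalSpace C^n⟮𝓡 q, M; 𝓘(ℝ, V), V⟯ :=
  ⨅ (ψ : OpenPartialHomeomorph M (EuclideanSpace ℝ (Fin q)))
    (_ : ψ ∈ IsManifold.maximalAtlas (𝓡 q) ∞ M) (k : ℕ) (_ : (k : ℕ∞ω) ≤ n),
    TopologicalSpace.induced
      (fun f : C^n⟮𝓡 q, M; 𝓘(ℝ, V), V⟯ =>
        UniformOnFun.ofFun {K : Set (EuclideanSpace ℝ (Fin q)) | IsCompact K ∧ K ⊆ ψ.target}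
          (iteratedFDeriv ℝ k (f ∘ ψ.symm)))
      inferInstance

/-- `f : M → V` is the generalized synchronization of the state map `F : V → Z → V` driven by the
observations `obs : M → Z` of the invertible dynamical system `φ` on `M`: for every `m`, the sequence
`t ↦ f (φ ^ t (m))`, `t ∈ ℤ`, is the one and only bounded sequence `x` that satisfies
`x t = F (x (t - 1)) (obs (φ ^ t (m)))` for all `t ∈ ℤ`. -/
def IsGeneralizedSynchronization {M Z V : Type*} [NormedAddCommGroup V]
    (φ : Equiv.Perm M) (obs : M → Z) (F : V → Z → V) (f : M → V) : Prop :=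
  ∀ (m : M) (x : ℤ → V),
    (Bornology.IsBounded (Set.range x) ∧
        ∀ t : ℤ, x t = F (x (t - 1)) (obs ((φ ^ t) m))) ↔
      x = fun t : ℤ => f ((φ ^ t) m)

/-- The linear state map `F(x, z) = A x + C z` with connectivity matrix `A` and input mask `C`. -/
def linearStateMap {N : ℕ} (A : Matrix (Fin N) (Fin N) ℝ) (C : Fin N → ℝ)
    (x : Fin N → ℝ) (z : ℝ) : Fin N → ℝ :=
  A.mulVec x + z • C

/-- The derivative `T_m φ⁻ⁿ : T_m M → T_m M` at a periodic point `m` of `φ`, where `n` is the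
(least) period of `m`. It is an endomorphism of `T_m M` since `φ⁻ⁿ (m) = m`. -/
noncomputable def returnDerivative {q : ℕ} {M : Type*} [TopologicalSpace M]
    [ChartedSpace (EuclideanSpace ℝ (Fin q)) M] (φ : M ≃ₘ^2⟮𝓡 q, 𝓡 q⟯ M) (m : M) :
    Module.End ℝ (TangentSpace (𝓡 q) m) :=
  (mfderiv (𝓡 q) (𝓡 q) (φ.symm^[Function.minimalPeriod φ m]) m :
    EuclideanSpace ℝ (Fin q) →L[ℝ] EuclideanSpace ℝ (Fin q)).toLinearMap

/-- The complex eigenvalues of `T_m φ⁻ⁿ`, for a periodic point `m` of `φ` of period `n`. -/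
def returnEigenvalues {q : ℕ} {M : Type*} [TopologicalSpace M]
    [ChartedSpace (EuclideanSpace ℝ (Fin q)) M] (φ : M ≃ₘ^2⟮𝓡 q, 𝓡 q⟯ M) (m : M) : Set ℂ :=
  {l : ℂ | Module.End.HasEigenvalue (LinearMap.baseChange ℂ (returnDerivative φ m)) l}

/-- A map from `M` to a normed space is immersive if its tangent map is injective at every point.
(For a `C^r` map, `1 ≤ r`, on a finite-dimensional manifold, this says that it is an immersion.) -/
def IsImmersive {q : ℕ} {M : Type*} [TopologicalSpace M]
    [ChartedSpace (EuclideanSpace ℝ (Fin q)) M] {V : Type*} [NormedAddCommGroup V]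
    [NormedSpace ℝ V] (f : M → V) : Prop :=
  ∀ m : M, Function.Injective (mfderiv (𝓡 q) 𝓘(ℝ, V) f m)

/-- The matrix `A`, with its entries regarded as complex numbers. -/
noncomputable def toComplexMatrix {N : ℕ} (A : Matrix (Fin N) (Fin N) ℝ) : Matrix (Fin N) (Fin N) ℂ :=
  A.map (algebraMap ℝ ℂ)

/-- The vector `(I - l Aⁿ)⁻¹ (I - A)⁻¹ (I - Aⁿ) C` in `ℂ ^ N`. -/
noncomputable def resolventVector {N : ℕ} (A : Matrix (Fin N) (Fin N) ℝ) (C : Fin N → ℝ)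
    (n : ℕ) (l : ℂ) : Fin N → ℂ :=
  ((1 - l • toComplexMatrix A ^ n)⁻¹ * (1 - toComplexMatrix A)⁻¹ *
    (1 - toComplexMatrix A ^ n)).mulVec (fun i => (C i : ℂ))

/-!
The generalized synchronization `f = Θ ω` satisfies `f = A (f ∘ φ⁻¹) + ω C`, hence
`f = ∑_{j < L} A ^ j C (ω ∘ φ⁻ʲ) + A ^ L (f ∘ φ⁻ᴸ)` for every `L`. By uniqueness of the bounded
solution `Θ` is linear, and it is bounded for the sup norms since `A ^ L → 0`. Injectivity of the
tangent map at all points of a compact set is an open condition in the `C²` topology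
(`ContMDiffMap.isOpen_setOf_injective_on`), so openness follows from the continuity of `Θ`, and
density can be proved locally on `M` (`dense_setOf_forall_of_finite_exceptions`).

At a point `m` that is not periodic, `ω ↦ D_m (Θ ω)` is onto all linear maps `T_m M → ℝ ^ N`
(`exists_chartDeriv_eq`). To see this, let `ω` be a linear function `ξ` of the coordinates at
`φ⁻ⁱ m`, cut off at scale `ε`. Only the `i`-th term of the sum sees `ω` near `m`, and one would like
to conclude that `D_m (Θ ω)` is close to the pullback of `ξ` times `A ^ i C`. The remainder
`A ^ L (f ∘ φ⁻ᴸ)` cannot be differentiated with control, as nothing relates the growth of `D φ⁻ᴸ` to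
the decay of `A ^ L`. But `ε ω` is bounded in `C²` (`uniformlyBounded_linearBump`), so by continuity
of `Θ` the second derivative of `f` is `O(1 / ε)`, whereas `f` itself is `O(ε)`. A difference
quotient with step `δ ε` therefore approximates `D_m f` up to `O(δ)`, and the remainder contributes
at most `O(‖A ^ L‖ / δ)` to it; choose `δ` first and then `L`
(`exists_norm_chartDeriv_sub_le`). The vectors `A ^ i C` span `ℝ ^ N`, so the range, which is closed
by finite dimension, is everything.

Given this, a finite-dimensional family of perturbations of `ω` acts on the derivative at each
point `x` near `m` by an invertible linear map. The parameters for which the derivative fails to be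
injective somewhere near `m` are covered by `C¹` images of a space of dimension
`q + (q - 1) + (q - 1) N < q N`, which is where `2 q ≤ N` enters, so their complement is dense
(`dense_setOf_injective_add`, `exists_mem_nhds_dense_injective_mfderiv`).

At a periodic point `m` of period `n`, the derivative `X` of `Θ ω` solves the linear equation
`X = A ^ n X (T_m φ⁻ⁿ) + ∑_{i < n} A ^ i C ⊗ D (ω ∘ φ⁻ⁱ)`. If all the covectors `D (ω ∘ φ⁻ⁱ)` are
equal to one `ξ`, then the complexification of `X` sends an eigenvector `v` with eigenvalue `λ` to
`ξ v` times `(1 - λ A ^ n)⁻¹ (1 - A)⁻¹ (1 - A ^ n) C`. These vectors are independent, so `X` is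
injective once `ξ` vanishes on none of the eigenvectors (`exists_dual_forall_injective`), and adding
a small multiple of such an observation to any given one makes its derivative injective.
-/

section Auxiliary

open Set Filter Topology

/-! ### The `C²` topology and injectivity of the tangent map -/

section Topology

variable {q : ℕ} {M : Type*} [TopologicalSpace M] [ChartedSpace (EuclideanSpace ℝ (Fin q)) M]
  {V : Type*} [NormedAddCommGroup V] [NormedSpace ℝ V]

theorem ContMDiffMap.tendsto_nhds_iff {n : ℕ∞ω} {ι : Type*} {l : Filter ι}
    {F : ι → C^n⟮𝓡 q, M; 𝓘(ℝ, V), V⟯} {g : C^n⟮𝓡 q, M; 𝓘(ℝ, V), V⟯} :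
    Tendsto F l (𝓝 g) ↔ ∀ ψ ∈ IsManifold.maximalAtlas (𝓡 q) ∞ M, ∀ k : ℕ, (k : ℕ∞ω) ≤ n →
      ∀ K ⊆ ψ.target, IsCompact K →
        TendstoUniformlyOn (fun i => iteratedFDeriv ℝ k (F i ∘ ψ.symm))
          (iteratedFDeriv ℝ k (g ∘ ψ.symm)) l K := by
  simp only [nhds_iInf, tendsto_iInf, nhds_induced, tendsto_comap_iff,
    UniformOnFun.tendsto_iff_tendstoUniformlyOn]
  refine forall₄_congr fun ψ _ k _ => ⟨fun h K hK hc => h K ⟨hc, hK⟩, fun h K hK => h K hK.2 hK.1⟩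

theorem ContMDiffMap.contDiffOn_comp_symm {n : ℕ∞} (g : C^n⟮𝓡 q, M; 𝓘(ℝ, V), V⟯)
    {ψ : OpenPartialHomeomorph M (EuclideanSpace ℝ (Fin q))}
    (hψ : ψ ∈ IsManifold.maximalAtlas (𝓡 q) ∞ M) : ContDiffOn ℝ n (g ∘ ψ.symm) ψ.target := by
  rw [← contMDiffOn_iff_contDiffOn]
  exact g.contMDiff.comp_contMDiffOn
    ((contMDiffOn_symm_of_mem_maximalAtlas hψ).of_le (by exact_mod_cast le_top))

theorem ContMDiffMap.eqOn_iteratedFDeriv_add {n : ℕ∞} (f g : C^n⟮𝓡 q, M; 𝓘(ℝ, V), V⟯)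
    {ψ : OpenPartialHomeomorph M (EuclideanSpace ℝ (Fin q))}
    (hψ : ψ ∈ IsManifold.maximalAtlas (𝓡 q) ∞ M) {k : ℕ} (hk : (k : ℕ∞ω) ≤ n) :
    EqOn (iteratedFDeriv ℝ k (⇑(f + g) ∘ ψ.symm))
      (iteratedFDeriv ℝ k (f ∘ ψ.symm) + iteratedFDeriv ℝ k (g ∘ ψ.symm)) ψ.target := by
  intro x hx
  have h (g : C^n⟮𝓡 q, M; 𝓘(ℝ, V), V⟯) : ContDiffAt ℝ k (g ∘ ψ.symm) x :=
    ((g.contDiffOn_comp_symm hψ).contDiffAt (ψ.open_target.mem_nhds hx)).of_le hk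
  exact iteratedFDeriv_add_apply (h f) (h g)

theorem ContMDiffMap.eqOn_iteratedFDeriv_smul {n : ℕ∞} (t : ℝ) (g : C^n⟮𝓡 q, M; 𝓘(ℝ, V), V⟯)
    {ψ : OpenPartialHomeomorph M (EuclideanSpace ℝ (Fin q))}
    (hψ : ψ ∈ IsManifold.maximalAtlas (𝓡 q) ∞ M) {k : ℕ} (hk : (k : ℕ∞ω) ≤ n) :
    EqOn (iteratedFDeriv ℝ k (⇑(t • g) ∘ ψ.symm))
      (t • iteratedFDeriv ℝ k (g ∘ ψ.symm)) ψ.target := by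
  intro x hx
  have h : ContDiffAt ℝ k (g ∘ ψ.symm) x :=
    ((g.contDiffOn_comp_symm hψ).contDiffAt (ψ.open_target.mem_nhds hx)).of_le hk
  exact iteratedFDeriv_const_smul_apply h

instance ContMDiffMap.instContinuousAdd {n : ℕ∞} :
    ContinuousAdd C^n⟮𝓡 q, M; 𝓘(ℝ, V), V⟯ := by
  refine ⟨continuous_iff_continuousAt.2 fun p => tendsto_nhds_iff.2 fun ψ hψ k hk K hK hKc => ?_⟩
  have h1 := tendsto_nhds_iff.1 (continuous_fst.tendsto p) ψ hψ k hk K hK hKc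
  have h2 := tendsto_nhds_iff.1 (continuous_snd.tendsto p) ψ hψ k hk K hK hKc
  refine ((h1.add h2).congr (.of_forall fun i x hx => ?_)).congr_right fun x hx => ?_
  · exact (eqOn_iteratedFDeriv_add i.1 i.2 hψ hk (hK hx)).symm
  · exact (eqOn_iteratedFDeriv_add p.1 p.2 hψ hk (hK hx)).symm

theorem ContMDiffMap.continuous_smul_const {n : ℕ∞} (g : C^n⟮𝓡 q, M; 𝓘(ℝ, V), V⟯) :
    Continuous fun t : ℝ => t • g := by
  refine continuous_iff_continuousAt.2 fun t => tendsto_nhds_iff.2 fun ψ hψ k hk K hK hKc => ?_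
  have hc : ContinuousOn (iteratedFDeriv ℝ k (g ∘ ψ.symm)) K :=
    (((g.contDiffOn_comp_symm hψ).continuousOn_iteratedFDerivWithin hk
      ψ.open_target.uniqueDiffOn).congr
      (iteratedFDerivWithin_of_isOpen k ψ.open_target).symm).mono hK
  obtain ⟨B, hB⟩ := hKc.exists_bound_of_continuousOn hc
  rw [Metric.tendstoUniformlyOn_iff]
  intro ε hε
  have hlim : Tendsto (fun s : ℝ => |t - s| * B) (𝓝 t) (𝓝 0) := by
    have : Continuous fun s : ℝ => |t - s| * B := by fun_prop
    simpa using this.tendsto t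
  filter_upwards [hlim.eventually_lt_const hε] with s hs x hx
  rw [eqOn_iteratedFDeriv_smul t g hψ hk (hK hx), eqOn_iteratedFDeriv_smul s g hψ hk (hK hx),
    Pi.smul_apply, Pi.smul_apply, dist_eq_norm, ← sub_smul, norm_smul, Real.norm_eq_abs]
  exact (mul_le_mul_of_nonneg_left (hB x hx) (abs_nonneg _)).trans_lt hs

/-- Finite-dimensional perturbations of `g` are continuous at `g` in their parameters. -/
theorem ContMDiffMap.tendsto_add_sum_smul {n : ℕ∞} {ι : Type*} [Fintype ι]
    (g : C^n⟮𝓡 q, M; 𝓘(ℝ, V), V⟯) (η : ι → C^n⟮𝓡 q, M; 𝓘(ℝ, V), V⟯) :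
    Tendsto (fun s : ι → ℝ => g + ∑ k, s k • η k) (𝓝 0) (𝓝 g) := by
  have h : Continuous fun s : ι → ℝ => g + ∑ k, s k • η k :=
    continuous_const.add (continuous_finsetSum _ fun k _ =>
      (continuous_smul_const (η k)).comp (continuous_apply k))
  simpa using h.tendsto 0

/-- The derivative of `g` at `x` read in the chart `ψ`, as a continuous linear map of the model
spaces. -/
noncomputable def chartDeriv (ψ : OpenPartialHomeomorph M (EuclideanSpace ℝ (Fin q))) (g : M → V)
    (x : M) : EuclideanSpace ℝ (Fin q) →L[ℝ] V :=
  fderiv ℝ (g ∘ ψ.symm) (ψ x)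

theorem chartDeriv_eq_mfderiv (g : M → V) (x : M)
    (hg : MDifferentiableAt (𝓡 q) 𝓘(ℝ, V) g x) :
    chartDeriv (chartAt _ x) g x = mfderiv (𝓡 q) 𝓘(ℝ, V) g x := by
  refine Eq.trans ?_ hg.mfderiv.symm
  simp [chartDeriv, writtenInExtChartAt, fderivWithin_univ, extChartAt, Function.comp_def,
    chartAt_self_eq]

theorem mfderiv_injective_iff_chartDeriv [IsManifold (𝓡 q) ∞ M] {g : M → V} {x y : M}
    (hg : MDifferentiableAt (𝓡 q) 𝓘(ℝ, V) g x)
    (hx : x ∈ (chartAt (EuclideanSpace ℝ (Fin q)) y).source) :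
    Function.Injective (mfderiv (𝓡 q) 𝓘(ℝ, V) g x) ↔
      Function.Injective (chartDeriv (chartAt (EuclideanSpace ℝ (Fin q)) y) g x) := by
  set ψ := chartAt (EuclideanSpace ℝ (Fin q)) y with hψ
  have hd := mdifferentiable_chart (I := 𝓡 q) y
  have hs : MDifferentiableAt (𝓡 q) (𝓡 q) ψ.symm (ψ x) :=
    hd.mdifferentiableAt_symm (ψ.map_source hx)
  have hg' : MDifferentiableAt (𝓡 q) 𝓘(ℝ, V) g (ψ.symm (ψ x)) := by rwa [ψ.left_inv hx]
  have hb := hd.symm.mfderiv_bijective (x := ψ x) (ψ.map_source hx)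
  have key : (chartDeriv ψ g x : EuclideanSpace ℝ (Fin q) → V) =
      mfderiv (𝓡 q) 𝓘(ℝ, V) g (ψ.symm (ψ x)) ∘ mfderiv (𝓡 q) (𝓡 q) ψ.symm (ψ x) := by
    have := mfderiv_comp (ψ x) hg' hs
    rw [chartDeriv, ← mfderiv_eq_fderiv, this]
    rfl
  rw [key, ψ.left_inv hx]
  exact (Function.Injective.of_comp_iff' _ hb).symm

/-- The derivative depends jointly continuously on the map and the point, since the `C²` topology
controls first derivatives locally uniformly. -/
theorem ContMDiffMap.tendsto_chartDeriv (g : C^2⟮𝓡 q, M; 𝓘(ℝ, V), V⟯)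
    {ψ : OpenPartialHomeomorph M (EuclideanSpace ℝ (Fin q))}
    (hψ : ψ ∈ IsManifold.maximalAtlas (𝓡 q) ∞ M) {x : M} (hx : x ∈ ψ.source) :
    Tendsto (fun p : C^2⟮𝓡 q, M; 𝓘(ℝ, V), V⟯ × M => chartDeriv ψ p.1 p.2) (𝓝 (g, x))
      (𝓝 (chartDeriv ψ g x)) := by
  obtain ⟨K, hKc, hxK, hK⟩ := exists_compact_subset ψ.open_target (ψ.map_source hx)
  have hKn : K ∈ 𝓝 (ψ x) := mem_interior_iff_mem_nhds.1 hxK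
  have hev (f : C^2⟮𝓡 q, M; 𝓘(ℝ, V), V⟯) (y : M) : chartDeriv ψ f y =
      continuousMultilinearCurryFin1 ℝ (EuclideanSpace ℝ (Fin q)) V
        (iteratedFDeriv ℝ 1 (f ∘ ψ.symm) (ψ y)) := by
    ext v
    simp [chartDeriv, iteratedFDeriv_one_apply]
  simp only [hev]
  refine ((continuousMultilinearCurryFin1 ℝ
    (EuclideanSpace ℝ (Fin q)) V).continuous.tendsto _).comp ?_
  have hu := tendsto_nhds_iff.1 (continuous_fst.tendsto (g, x)) ψ hψ 1 (by norm_num) K hK hKc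
  refine hu.tendsto_comp (ContinuousAt.continuousWithinAt ?_) ?_
  · refine (((g.contDiffOn_comp_symm hψ).continuousOn_iteratedFDerivWithin (m := 1)
      (by norm_num) ψ.open_target.uniqueDiffOn).congr
      (iteratedFDerivWithin_of_isOpen 1 ψ.open_target).symm).continuousAt
      (ψ.open_target.mem_nhds (ψ.map_source hx))
  · have : Tendsto (fun p : C^2⟮𝓡 q, M; 𝓘(ℝ, V), V⟯ × M => ψ p.2) (𝓝 (g, x)) (𝓝 (ψ x)) :=
      (ψ.continuousAt hx).tendsto.comp (continuous_snd.tendsto (g, x))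
    rwa [nhdsWithin_eq_nhds.2 hKn]

theorem ContMDiffMap.eventually_mfderiv_injective [IsManifold (𝓡 q) ∞ M]
    (g : C^2⟮𝓡 q, M; 𝓘(ℝ, V), V⟯) {x : M}
    (hx : Function.Injective (mfderiv (𝓡 q) 𝓘(ℝ, V) g x)) :
    ∀ᶠ p : C^2⟮𝓡 q, M; 𝓘(ℝ, V), V⟯ × M in 𝓝 (g, x),
      Function.Injective (mfderiv (𝓡 q) 𝓘(ℝ, V) p.1 p.2) := by
  have hd (f : C^2⟮𝓡 q, M; 𝓘(ℝ, V), V⟯) (y : M) : MDifferentiableAt (𝓡 q) 𝓘(ℝ, V) f y :=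
    (f.contMDiff y).mdifferentiableAt two_ne_zero
  have hs := mem_chart_source (EuclideanSpace ℝ (Fin q)) x
  have h1 := g.tendsto_chartDeriv (IsManifold.chart_mem_maximalAtlas x) hs
  rw [mfderiv_injective_iff_chartDeriv (hd _ _) hs] at hx
  have h2 := h1.eventually (ContinuousLinearMap.isOpen_injective.mem_nhds hx)
  have h3 : ∀ᶠ p : C^2⟮𝓡 q, M; 𝓘(ℝ, V), V⟯ × M in 𝓝 (g, x),
      p.2 ∈ (chartAt (EuclideanSpace ℝ (Fin q)) x).source :=
    continuous_snd.tendsto (g, x) ((chartAt _ x).open_source.mem_nhds hs)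
  filter_upwards [h2, h3] with p hp hp'
  exact (mfderiv_injective_iff_chartDeriv (hd _ _) hp').2 hp

/-- The tube lemma turns the local statement `ContMDiffMap.eventually_mfderiv_injective` into
openness over a compact set of points. -/
theorem ContMDiffMap.isOpen_setOf_injective_on [IsManifold (𝓡 q) ∞ M] {K : Set M}
    (hK : IsCompact K) :
    IsOpen {g : C^2⟮𝓡 q, M; 𝓘(ℝ, V), V⟯ |
      ∀ x ∈ K, Function.Injective (mfderiv (𝓡 q) 𝓘(ℝ, V) g x)} := by
  refine isOpen_iff_mem_nhds.2 fun g hg => ?_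
  have h := hK.mem_nhdsSet_prod_of_forall (l := 𝓝 g)
    (s := {p | Function.Injective (mfderiv (𝓡 q) 𝓘(ℝ, V) p.2 p.1)}) fun x hx => by
      rw [← nhds_prod_eq]
      exact (continuous_swap.tendsto (x, g)).eventually (g.eventually_mfderiv_injective (hg x hx))
  obtain ⟨s, hs, t, ht, hst⟩ := Filter.mem_prod_iff.1 h
  filter_upwards [ht] with f hf x hx
  exact hst (Set.mk_mem_prod (subset_of_mem_nhdsSet hs hx) hf)

end Topology

/-! ### Powers of a matrix of spectral radius less than one -/

section Spectral

variable {N : ℕ} {A : Matrix (Fin N) (Fin N) ℝ}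

section
attribute [local instance] Matrix.linftyOpNormedRing Matrix.linftyOpNormedAlgebra

/-- By Gelfand's formula, the powers of an element of spectral radius less than one tend to zero. -/
theorem tendsto_pow_zero_of_spectralRadius_lt_one {R : Type*} [NormedRing R] [NormedAlgebra ℂ R]
    [CompleteSpace R] {a : R} (ha : spectralRadius ℂ a < 1) :
    Tendsto (fun n : ℕ => a ^ n) atTop (𝓝 0) := by
  obtain ⟨r, har, hr1⟩ := ENNReal.lt_iff_exists_nnreal_btwn.1 ha
  have hr1' : (r : ℝ) < 1 := by exact_mod_cast hr1
  have hlim := tendsto_pow_atTop_nhds_zero_of_lt_one r.coe_nonneg hr1'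
  rw [tendsto_zero_iff_norm_tendsto_zero]
  refine squeeze_zero' (.of_forall fun n => norm_nonneg _) ?_ hlim
  have hG := spectrum.pow_nnnorm_pow_one_div_tendsto_nhds_spectralRadius a
  filter_upwards [hG.eventually_lt_const har, eventually_gt_atTop 0] with n hn hn0
  rw [one_div, ENNReal.rpow_inv_lt_iff (by exact_mod_cast hn0), ENNReal.rpow_natCast] at hn
  exact_mod_cast hn.le

theorem eventually_norm_pow_mulVec_le (hρ : spectralRadius ℂ (toComplexMatrix A) < 1) {e : ℝ}
    (he : 0 < e) : ∀ᶠ L : ℕ in atTop, ∀ x : Fin N → ℝ, ‖(A ^ L).mulVec x‖ ≤ e * ‖x‖ := by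
  have h := tendsto_pow_zero_of_spectralRadius_lt_one hρ
  rw [tendsto_zero_iff_norm_tendsto_zero] at h
  filter_upwards [h.eventually_lt_const he] with L hL x
  have h1 : ‖toComplexMatrix A ^ L‖ = ‖A ^ L‖ := by
    rw [toComplexMatrix, ← Matrix.map_pow]
    simp [Matrix.linfty_opNorm_def]
  rw [h1] at hL
  exact (Matrix.linfty_opNorm_mulVec _ _).trans (by gcongr)

end

/-- If `1` were an eigenvalue `l μ ^ n` of `l b ^ n`, then `|l' μ ^ k| ≥ |l μ ^ n| = 1` because
`|μ| < 1`, against the bound on the spectral radius of `l' b ^ k`. -/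
theorem isUnit_one_sub_smul_pow {R : Type*} [Ring R] [Algebra ℂ R] {b : R}
    (hb : spectralRadius ℂ b < 1) {l l' : ℂ} {k n : ℕ} (hk : 0 < k) (hkn : k ≤ n) (hl : ‖l‖ ≤ ‖l'‖)
    (h : spectralRadius ℂ (l' • b ^ k) < 1) : IsUnit (1 - l • b ^ n) := by
  by_contra hu
  have hl0 : l ≠ 0 := by rintro rfl; simp at hu
  have hl0' : l' ≠ 0 := by rintro rfl; simp [hl0] at hl
  have h1 : (1 : ℂ) ∈ spectrum ℂ (l • b ^ n) := by rwa [spectrum.mem_iff, map_one]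
  rw [← Units.smul_mk0 hl0, spectrum.unit_smul_eq_smul,
    spectrum.map_pow_of_pos b (hk.trans_le hkn)] at h1
  obtain ⟨_, ⟨μ, hμ, rfl⟩, hμ1⟩ := Set.mem_smul_set.1 h1
  have h2 : (l' * μ ^ k) ∈ spectrum ℂ (l' • b ^ k) := by
    rw [← Units.smul_mk0 hl0', spectrum.unit_smul_eq_smul, spectrum.map_pow_of_pos b hk]
    exact Set.mem_smul_set.2 ⟨μ ^ k, ⟨μ, hμ, rfl⟩, rfl⟩
  have h3 : ‖μ‖ < 1 := by
    have := (le_iSup₂ (f := fun (k : ℂ) (_ : k ∈ spectrum ℂ b) => (‖k‖₊ : ENNReal))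
      μ hμ).trans_lt hb
    exact_mod_cast this
  have h4 : ‖l' * μ ^ k‖ < 1 := by
    have := (le_iSup₂ (f := fun (z : ℂ) (_ : z ∈ spectrum ℂ (l' • b ^ k)) => (‖z‖₊ : ENNReal))
      _ h2).trans_lt h
    exact_mod_cast this
  have h5 : ‖l‖ * ‖μ‖ ^ n = 1 := by
    have : l * μ ^ n = 1 := hμ1
    rw [← norm_pow, ← norm_mul, this, norm_one]
  rw [norm_mul, norm_pow] at h4
  have h6 : ‖μ‖ ^ n ≤ ‖μ‖ ^ k := pow_le_pow_of_le_one (norm_nonneg _) h3.le hkn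
  nlinarith [mul_le_mul hl h6 (by positivity) (norm_nonneg l')]

end Spectral

/-! ### Linearity and sup norm bound of the synchronization -/

section Synchronization

variable {N : ℕ} {A : Matrix (Fin N) (Fin N) ℝ} {C : Fin N → ℝ} {M : Type*} {φ : Equiv.Perm M}
  {obs obs' : M → ℝ} {f f' : M → Fin N → ℝ}

namespace IsGeneralizedSynchronization

theorem apply_eq (h : IsGeneralizedSynchronization φ obs (linearStateMap A C) f) (m : M) :
    f m = A.mulVec (f (φ.symm m)) + obs m • C := by
  simpa [linearStateMap] using ((h m _).2 rfl).2 0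

theorem apply_eq_sum (h : IsGeneralizedSynchronization φ obs (linearStateMap A C) f) (L : ℕ)
    (m : M) :
    f m = ∑ j ∈ Finset.range L, obs (φ.symm^[j] m) • (A ^ j).mulVec C +
      (A ^ L).mulVec (f (φ.symm^[L] m)) := by
  induction L with
  | zero => simp
  | succ L ih =>
    rw [ih, Finset.sum_range_succ, h.apply_eq (φ.symm^[L] m), Function.iterate_succ_apply',
      Matrix.mulVec_add, Matrix.mulVec_smul, Matrix.mulVec_mulVec, ← pow_succ]
    abel

/-- A synchronization depends linearly on the observation: a linear combination of bounded solutions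
is a bounded solution for the combined observation, hence the only one. -/
theorem add_smul (h : IsGeneralizedSynchronization φ obs (linearStateMap A C) f)
    (h' : IsGeneralizedSynchronization φ obs' (linearStateMap A C) f') (c : ℝ) {g : M → Fin N → ℝ}
    (hg : IsGeneralizedSynchronization φ (fun m => obs m + c * obs' m) (linearStateMap A C) g)
    (m : M) : g m = f m + c • f' m := by
  have h1 := (h m _).2 rfl
  have h2 := (h' m _).2 rfl
  have h3 := (hg m fun t => f ((φ ^ t) m) + c • f' ((φ ^ t) m)).1 ⟨?_, fun t => ?_⟩
  · simpa using (congrFun h3 0).symm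
  · obtain ⟨R, hR⟩ := isBounded_iff_forall_norm_le.1 h1.1
    obtain ⟨R', hR'⟩ := isBounded_iff_forall_norm_le.1 h2.1
    refine isBounded_iff_forall_norm_le.2 ⟨R + |c| * R', ?_⟩
    rintro _ ⟨t, rfl⟩
    refine (norm_add_le _ _).trans (add_le_add (hR _ ⟨t, rfl⟩) ?_)
    rw [norm_smul, Real.norm_eq_abs]
    exact mul_le_mul_of_nonneg_left (hR' _ ⟨t, rfl⟩) (abs_nonneg _)
  · have e1 := h1.2 t
    have e2 := h2.2 t
    simp only [linearStateMap] at e1 e2 ⊢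
    rw [e1, e2, Matrix.mulVec_add, Matrix.mulVec_smul]
    module

/-- The synchronization is bounded for the sup norms: with `‖A ^ L x‖ ≤ ‖x‖ / 2`, the supremum `s`
of `‖f‖` satisfies `s ≤ S b + s / 2`. -/
theorem exists_norm_le (hρ : spectralRadius ℂ (toComplexMatrix A) < 1) (φ : Equiv.Perm M)
    (C : Fin N → ℝ) :
    ∃ B : ℝ, 0 ≤ B ∧ ∀ (obs : M → ℝ) (f : M → Fin N → ℝ) (b : ℝ),
      IsGeneralizedSynchronization φ obs (linearStateMap A C) f →
      Bornology.IsBounded (range f) → (∀ m, |obs m| ≤ b) → ∀ m, ‖f m‖ ≤ B * b := by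
  obtain ⟨L, hL⟩ := (eventually_norm_pow_mulVec_le hρ one_half_pos).exists
  set S := ∑ j ∈ Finset.range L, ‖(A ^ j).mulVec C‖ with hS
  have hS0 : 0 ≤ S := Finset.sum_nonneg fun _ _ => norm_nonneg _
  refine ⟨2 * S, by positivity, fun obs f b h hf hb m => ?_⟩
  obtain ⟨R, hR⟩ := isBounded_iff_forall_norm_le.1 hf
  have : Nonempty M := ⟨m⟩
  have hbdd : BddAbove (range fun m => ‖f m‖) := ⟨R, by rintro _ ⟨y, rfl⟩; exact hR _ ⟨y, rfl⟩⟩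
  set s := ⨆ m, ‖f m‖ with hs
  have key (y : M) : ‖f y‖ ≤ S * b + 1 / 2 * s := by
    rw [h.apply_eq_sum L y]
    refine (norm_add_le _ _).trans (add_le_add ?_ ?_)
    · refine (norm_sum_le _ _).trans ?_
      rw [hS, Finset.sum_mul]
      refine Finset.sum_le_sum fun j _ => ?_
      rw [norm_smul, mul_comm]
      exact mul_le_mul_of_nonneg_left (hb _) (norm_nonneg _)
    · refine (hL _).trans ?_
      gcongr
      exact le_ciSup hbdd _
  have h1 : s ≤ S * b + 1 / 2 * s := ciSup_le key
  linarith [key m]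

end IsGeneralizedSynchronization

theorem exists_linearMap_eq_of_isGeneralizedSynchronization {q : ℕ} [TopologicalSpace M]
    [ChartedSpace (EuclideanSpace ℝ (Fin q)) M]
    (Θ : C^2⟮𝓡 q, M; 𝓘(ℝ, ℝ), ℝ⟯ → C^2⟮𝓡 q, M; 𝓘(ℝ, Fin N → ℝ), Fin N → ℝ⟯)
    (hΘ : ∀ obs : C^2⟮𝓡 q, M; 𝓘(ℝ, ℝ), ℝ⟯,
      IsGeneralizedSynchronization φ obs (linearStateMap A C) (Θ obs)) :
    ∃ T : C^2⟮𝓡 q, M; 𝓘(ℝ, ℝ), ℝ⟯ →ₗ[ℝ] C^2⟮𝓡 q, M; 𝓘(ℝ, Fin N → ℝ), Fin N → ℝ⟯, ⇑T = Θ := by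
  have key (c : ℝ) (g g' : C^2⟮𝓡 q, M; 𝓘(ℝ, ℝ), ℝ⟯) : Θ (g + c • g') = Θ g + c • Θ g' :=
    ContMDiffMap.ext fun m => (hΘ g).add_smul (hΘ g') c (hΘ (g + c • g')) m
  have hadd (g g') : Θ (g + g') = Θ g + Θ g' := by simpa using key 1 g g'
  have h0 : Θ 0 = 0 := by simpa using hadd 0 0
  exact ⟨{ toFun := Θ, map_add' := hadd, map_smul' := fun c g => by simpa [h0] using key c 0 g },
    rfl⟩

end Synchronization

/-! ### Bounded families of maps and rescaled bump functions -/

section Bounded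

variable {q : ℕ} {M : Type*} [TopologicalSpace M] [ChartedSpace (EuclideanSpace ℝ (Fin q)) M]
  {V W : Type*} [NormedAddCommGroup V] [NormedSpace ℝ V] [NormedAddCommGroup W] [NormedSpace ℝ W]

/-- A family of `C^n` maps is `C^n`-bounded if in every chart its derivatives up to order `n` are
uniformly bounded on compact sets. -/
def ContMDiffMap.UniformlyBounded {n : ℕ∞} {ι : Type*} (F : ι → C^n⟮𝓡 q, M; 𝓘(ℝ, V), V⟯) : Prop :=
  ∀ ψ ∈ IsManifold.maximalAtlas (𝓡 q) ∞ M, ∀ k : ℕ, (k : ℕ∞ω) ≤ n →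
    ∀ K ⊆ ψ.target, IsCompact K →
      ∃ B : ℝ, ∀ i, ∀ z ∈ K, ‖iteratedFDeriv ℝ k (F i ∘ ψ.symm) z‖ ≤ B

/-- If `F i` is `C^n`-bounded then `t • F i → 0` uniformly in `i` as `t → 0`; this survives `T`, and
a single `t > 0` then bounds `T (F i)`. -/
theorem ContMDiffMap.UniformlyBounded.map {n : ℕ∞} {ι : Type*}
    {F : ι → C^n⟮𝓡 q, M; 𝓘(ℝ, V), V⟯} (hF : UniformlyBounded F)
    (T : C^n⟮𝓡 q, M; 𝓘(ℝ, V), V⟯ →ₗ[ℝ] C^n⟮𝓡 q, M; 𝓘(ℝ, W), W⟯) (hT : Continuous T) :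
    UniformlyBounded fun i => T (F i) := by
  have hlim : Tendsto (fun p : ℝ × ι => p.1 • F p.2) (𝓝 0 ×ˢ ⊤) (𝓝 0) := by
    refine tendsto_nhds_iff.2 fun ψ hψ k hk K hK hKc => ?_
    obtain ⟨B, hB⟩ := hF ψ hψ k hk K hK hKc
    rw [Metric.tendstoUniformlyOn_iff]
    intro ε hε
    have h0 : Tendsto (fun s : ℝ => |s| * B) (𝓝 0) (𝓝 0) := by
      have : Continuous fun s : ℝ => |s| * B := by fun_prop
      simpa using this.tendsto 0
    filter_upwards [(h0.eventually_lt_const hε).prod_inl _] with p hp z hz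
    have hz0 : iteratedFDeriv ℝ k (⇑(0 : C^n⟮𝓡 q, M; 𝓘(ℝ, V), V⟯) ∘ ψ.symm) z = 0 := by
      simpa only [zero_smul, Pi.zero_apply] using
        eqOn_iteratedFDeriv_smul 0 (0 : C^n⟮𝓡 q, M; 𝓘(ℝ, V), V⟯) hψ hk (hK hz)
    rw [hz0, eqOn_iteratedFDeriv_smul _ _ hψ hk (hK hz), dist_zero_left, Pi.smul_apply, norm_smul,
      Real.norm_eq_abs]
    exact (mul_le_mul_of_nonneg_left (hB _ z hz) (abs_nonneg _)).trans_lt hp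
  have hT0 : Tendsto T (𝓝 0) (𝓝 0) := by simpa using hT.tendsto 0
  intro ψ hψ k hk K hK hKc
  have h1 := tendsto_nhds_iff.1 (hT0.comp hlim) ψ hψ k hk K hK hKc
  rw [Metric.tendstoUniformlyOn_iff] at h1
  have h2 := h1 1 one_pos
  rw [← principal_univ, eventually_prod_principal_iff] at h2
  obtain ⟨t, ht, ht0⟩ := ((h2.filter_mono nhdsWithin_le_nhds).and
    (self_mem_nhdsWithin : Ioi (0 : ℝ) ∈ 𝓝[>] 0)).exists
  have ht0 : 0 < t := ht0
  refine ⟨t⁻¹, fun i z hz => ?_⟩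
  have h3 := ht i (mem_univ _) z hz
  have hz0 : iteratedFDeriv ℝ k (⇑(0 : C^n⟮𝓡 q, M; 𝓘(ℝ, W), W⟯) ∘ ψ.symm) z = 0 := by
    simpa only [zero_smul, Pi.zero_apply] using
      eqOn_iteratedFDeriv_smul 0 (0 : C^n⟮𝓡 q, M; 𝓘(ℝ, W), W⟯) hψ hk (hK hz)
  rw [hz0, dist_zero_left, Function.comp_apply, map_smul,
    eqOn_iteratedFDeriv_smul _ _ hψ hk (hK hz), Pi.smul_apply, norm_smul, Real.norm_eq_abs,
    abs_of_pos ht0] at h3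
  rw [← one_div, le_div_iff₀ ht0, mul_comm]
  exact h3.le

end Bounded

section Bump

theorem two_le_infty : (2 : ℕ∞ω) ≤ ∞ :=
  (WithTop.coe_le_coe.2 le_top : ((2 : ℕ∞) : ℕ∞ω) ≤ ∞)

variable {q : ℕ} {M : Type*} [TopologicalSpace M] [ChartedSpace (EuclideanSpace ℝ (Fin q)) M]
  [IsManifold (𝓡 q) ∞ M] [T2Space M]

/-- The linear function `ξ` of the coordinates at `p`, centred at `p` and cut off by the bump
function `b`. -/
noncomputable def linearBump {p : M} (b : SmoothBumpFunction (𝓡 q) p)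
    (ξ : EuclideanSpace ℝ (Fin q) →L[ℝ] ℝ) : C^2⟮𝓡 q, M; 𝓘(ℝ, ℝ), ℝ⟯ :=
  ⟨fun x => b x • ξ (chartAt _ p x - chartAt _ p p), by
    refine (b.contMDiff_smul ?_).of_le two_le_infty
    have h := contMDiffOn_of_mem_maximalAtlas (I := 𝓡 q) (n := ∞)
      (IsManifold.chart_mem_maximalAtlas (I := 𝓡 q) p)
    have h2 : ContDiff ℝ ∞ fun y : EuclideanSpace ℝ (Fin q) => ξ (y - chartAt _ p p) := by fun_prop
    exact h2.contMDiff.comp_contMDiffOn h⟩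

variable {p : M} {b : SmoothBumpFunction (𝓡 q) p} {ξ : EuclideanSpace ℝ (Fin q) →L[ℝ] ℝ} {x : M}

theorem linearBump_apply : linearBump b ξ x = b x * ξ (chartAt _ p x - chartAt _ p p) := rfl

theorem mem_of_linearBump_ne_zero (h : linearBump b ξ x ≠ 0) :
    x ∈ (chartAt (EuclideanSpace ℝ (Fin q)) p).source ∧
      dist (chartAt (EuclideanSpace ℝ (Fin q)) p x) (chartAt _ p p) < b.rOut := by
  have : x ∈ Function.support b := left_ne_zero_of_mul h
  rw [b.support_eq_inter_preimage] at this
  exact this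

theorem linearBump_of_dist_le (hx : x ∈ (chartAt (EuclideanSpace ℝ (Fin q)) p).source)
    (hd : dist (chartAt (EuclideanSpace ℝ (Fin q)) p x) (chartAt _ p p) ≤ b.rIn) :
    linearBump b ξ x = ξ (chartAt _ p x - chartAt _ p p) := by
  rw [linearBump_apply, b.one_of_dist_le hx hd, one_mul]

theorem abs_linearBump_le : |linearBump b ξ x| ≤ ‖ξ‖ * b.rOut := by
  by_cases h : linearBump b ξ x = 0
  · rw [h, abs_zero]
    exact mul_nonneg (norm_nonneg _) b.rOut_pos.le
  · have hd := (mem_of_linearBump_ne_zero h).2.le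
    rw [linearBump_apply, abs_mul, abs_of_nonneg b.nonneg]
    rw [dist_eq_norm] at hd
    calc b x * |ξ (chartAt _ p x - chartAt _ p p)| ≤ 1 * (‖ξ‖ * b.rOut) := by
          refine mul_le_mul b.le_one ?_ (abs_nonneg _) zero_le_one
          exact (ξ.le_opNorm _).trans (by gcongr)
      _ = _ := one_mul _

/-- The cut-off linear functions at scale `ε = b.rIn`, multiplied by `ε`, are bounded in `C²`. In
the chart at `p` they are `ε ^ 2 H ((· - p) / ε)` with a fixed profile `H`, and two derivatives cost at
most `ε ^ (-2)`. The hypothesis `hR` keeps their supports in a fixed compact part of the chart. -/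
theorem uniformlyBounded_linearBump (p : M) (ξ : EuclideanSpace ℝ (Fin q) →L[ℝ] ℝ) {R : ℝ}
    (hR1 : R ≤ 1)
    (hR : Metric.closedBall (chartAt (EuclideanSpace ℝ (Fin q)) p p) (2 * R) ⊆
      (chartAt (EuclideanSpace ℝ (Fin q)) p).target) :
    ContMDiffMap.UniformlyBounded
      fun b : {b : SmoothBumpFunction (𝓡 q) p // b.rOut = 2 * b.rIn ∧ b.rIn ≤ R} =>
        b.1.rIn • linearBump b.1 ξ := by
  intro ψ hψ k hk K hK hKc
  set e := chartAt (EuclideanSpace ℝ (Fin q)) p with he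
  have heA : e ∈ IsManifold.maximalAtlas (𝓡 q) ∞ M := IsManifold.chart_mem_maximalAtlas p
  have hk2 : k ≤ 2 := by exact_mod_cast hk
  -- the profile of which all the bumps are rescaled copies
  let β : ContDiffBump (0 : EuclideanSpace ℝ (Fin q)) := ⟨1, 2, one_pos, one_lt_two⟩
  set H : EuclideanSpace ℝ (Fin q) → ℝ := fun u => β u * ξ u with hH
  have hHs : ContDiff ℝ 2 H := β.contDiff.mul ξ.contDiff
  have hHc : HasCompactSupport H := β.hasCompactSupport.mul_right
  obtain ⟨CH, hCH⟩ : ∃ CH, ∀ i ≤ k, ∀ u, ‖iteratedFDeriv ℝ i H u‖ ≤ CH := by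
    have : ∀ i ≤ k, ∃ c, ∀ u, ‖iteratedFDeriv ℝ i H u‖ ≤ c := fun i hi =>
      (hHc.iteratedFDeriv i).exists_bound_of_continuous
        (hHs.continuous_iteratedFDeriv (by exact_mod_cast hi.trans hk2))
    choose! c hc using this
    refine ⟨∑ i ∈ Finset.range (k + 1), c i, fun i hi u => (hc i hi u).trans ?_⟩
    refine Finset.single_le_sum (f := c) (fun j hj => ?_) (Finset.mem_range_succ_iff.2 hi)
    exact (norm_nonneg _).trans (hc j (Finset.mem_range_succ_iff.1 hj) 0)
  -- the part of `K` that the supports can reach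
  set Q : Set M := e.symm '' Metric.closedBall (e p) (2 * R) with hQ
  have hQc : IsCompact Q := (isCompact_closedBall _ _).image_of_continuousOn
    (e.continuousOn_symm.mono hR)
  set O : Set (EuclideanSpace ℝ (Fin q)) := ψ.target ∩ ψ.symm ⁻¹' e.source with hO
  have hOo : IsOpen O := ψ.symm.isOpen_inter_preimage e.open_source
  have hQe : Q ⊆ e.source := by
    rintro _ ⟨y, hy, rfl⟩
    exact e.map_target (hR hy)
  have hK' : IsCompact (K ∩ ψ.symm ⁻¹' Q) :=
    hKc.of_isClosed_subset ((ψ.continuousOn_symm.mono hK).preimage_isClosed_of_isClosed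
      hKc.isClosed hQc.isClosed) inter_subset_left
  have hK'O : K ∩ ψ.symm ⁻¹' Q ⊆ O := fun z hz => ⟨hK hz.1, hQe hz.2⟩
  set τ : EuclideanSpace ℝ (Fin q) → EuclideanSpace ℝ (Fin q) := fun z => e (ψ.symm z) with hτ
  have hτs : ContDiffOn ℝ 2 τ O := by
    rw [← contMDiffOn_iff_contDiffOn]
    exact ((contMDiffOn_of_mem_maximalAtlas heA).comp
      ((contMDiffOn_symm_of_mem_maximalAtlas hψ).mono inter_subset_left)
      fun z hz => hz.2).of_le two_le_infty
  obtain ⟨D, hD1, hD⟩ : ∃ D : ℝ, 1 ≤ D ∧ ∀ i ≤ k, ∀ z ∈ K ∩ ψ.symm ⁻¹' Q,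
      ‖iteratedFDerivWithin ℝ i τ O z‖ ≤ D := by
    have : ∀ i ≤ k, ∃ c, 0 ≤ c ∧ ∀ z ∈ K ∩ ψ.symm ⁻¹' Q, ‖iteratedFDerivWithin ℝ i τ O z‖ ≤ c := by
      intro i hi
      obtain ⟨c, hc⟩ := hK'.exists_bound_of_continuousOn
        ((hτs.continuousOn_iteratedFDerivWithin (m := i) (by exact_mod_cast hi.trans hk2)
          hOo.uniqueDiffOn).mono hK'O)
      exact ⟨max c 0, le_max_right _ _, fun z hz => (hc z hz).trans (le_max_left _ _)⟩
    choose! c hc0 hc using this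
    refine ⟨1 + ∑ i ∈ Finset.range (k + 1), c i, ?_, fun i hi z hz => (hc i hi z hz).trans ?_⟩
    · have := Finset.sum_nonneg fun j (hj : j ∈ Finset.range (k + 1)) =>
        hc0 j (Finset.mem_range_succ_iff.1 hj)
      linarith
    · have := Finset.single_le_sum (f := c) (fun j hj => hc0 j (Finset.mem_range_succ_iff.1 hj))
        (Finset.mem_range_succ_iff.2 hi)
      linarith
  have hCH0 : 0 ≤ CH := (norm_nonneg _).trans (hCH 0 (Nat.zero_le _) 0)
  refine ⟨k.factorial * CH * D ^ k, ?_⟩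
  rintro ⟨b, hb2, hbR⟩ z hz
  have hpos : 0 < b.rIn := b.rIn_pos
  by_cases hzQ : ψ.symm z ∈ Q
  · have hzO : z ∈ O := hK'O ⟨hz, hzQ⟩
    set f : EuclideanSpace ℝ (Fin q) → EuclideanSpace ℝ (Fin q) :=
      fun z => b.rIn⁻¹ • (τ z - e p) with hf
    have hfs : ContDiffOn ℝ 2 f O := (hτs.sub contDiffOn_const).const_smul _
    have heq : EqOn (⇑(b.rIn • linearBump b ξ) ∘ ψ.symm) ((b.rIn ^ 2) • (H ∘ f)) O := by
      intro y hy
      have h1 : b (ψ.symm y) = β (f y) := by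
        rw [b.eqOn_source hy.2]
        simp only [Function.comp_apply, ContDiffBump.apply, hb2, hf, hτ, β]
        rw [mul_div_cancel_right₀ _ hpos.ne']
        simp [he]
      simp only [Function.comp_apply, Pi.smul_apply, smul_eq_mul, hH, ← h1]
      change b.rIn * (b (ψ.symm y) * ξ (τ y - e p)) = _
      simp only [hf, map_smul, smul_eq_mul]
      field_simp
    have hcomp : ‖iteratedFDerivWithin ℝ k (H ∘ f) O z‖ ≤ k.factorial * CH * (D / b.rIn) ^ k := by
      refine norm_iteratedFDerivWithin_comp_le (N := 2) hHs.contDiffOn hfs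
        (by exact_mod_cast hk2) uniqueDiffOn_univ hOo.uniqueDiffOn (mapsTo_univ _ _) hzO
        (fun i hi => by rw [iteratedFDerivWithin_univ]; exact hCH i hi _) fun i hi1 hi => ?_
      have h2 : iteratedFDerivWithin ℝ i f O z = b.rIn⁻¹ • iteratedFDerivWithin ℝ i τ O z := by
        have hτi : ContDiffWithinAt ℝ i τ O z := (hτs z hzO).of_le (by exact_mod_cast hi.trans hk2)
        have h3 : f = b.rIn⁻¹ • (τ - fun _ => e p) := rfl
        have h4 : ContDiffWithinAt ℝ i (τ - fun _ => e p) O z := hτi.sub contDiffWithinAt_const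
        rw [h3, iteratedFDerivWithin_const_smul_apply h4
          hOo.uniqueDiffOn hzO, iteratedFDerivWithin_sub_apply hτi contDiffWithinAt_const
          hOo.uniqueDiffOn hzO, iteratedFDerivWithin_const_of_ne (by omega), Pi.zero_apply,
          sub_zero]
      rw [h2, norm_smul, norm_inv, Real.norm_of_nonneg hpos.le, ← div_eq_inv_mul]
      refine (div_le_div_of_nonneg_right (hD i hi z ⟨hz, hzQ⟩) hpos.le).trans ?_
      refine le_self_pow₀ ?_ (by omega)
      rw [one_le_div hpos]
      linarith
    have hH2 : ContDiffWithinAt ℝ k (H ∘ f) O z :=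
      (hHs.comp_contDiffOn hfs z hzO).of_le (by exact_mod_cast hk2)
    rw [← iteratedFDerivWithin_of_isOpen k hOo hzO, iteratedFDerivWithin_congr heq hzO,
      iteratedFDerivWithin_const_smul_apply hH2 hOo.uniqueDiffOn hzO, norm_smul,
      Real.norm_of_nonneg (by positivity)]
    calc b.rIn ^ 2 * ‖iteratedFDerivWithin ℝ k (H ∘ f) O z‖
        ≤ b.rIn ^ k * (k.factorial * CH * (D / b.rIn) ^ k) := by
          refine mul_le_mul (pow_le_pow_of_le_one hpos.le (hbR.trans hR1) hk2) hcomp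
            (norm_nonneg _) (by positivity)
      _ = k.factorial * CH * D ^ k := by
          rw [div_pow]
          field_simp
  · have heq : ⇑(b.rIn • linearBump b ξ) ∘ ψ.symm =ᶠ[𝓝 z] fun _ => 0 := by
      have : ∀ᶠ y in 𝓝 z, ψ.symm y ∈ Qᶜ :=
        (ψ.continuousAt_symm (hK hz)).eventually (hQc.isClosed.isOpen_compl.mem_nhds hzQ)
      filter_upwards [this] with y hy
      by_contra hne
      have hne' : linearBump b ξ (ψ.symm y) ≠ 0 := fun h => hne (by simp [h])
      obtain ⟨h1, h2⟩ := mem_of_linearBump_ne_zero hne'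
      refine hy ⟨e (ψ.symm y), ?_, e.left_inv h1⟩
      rw [Metric.mem_closedBall]
      linarith
    rw [(heq.iteratedFDeriv ℝ k).eq_of_nhds]
    simp only [iteratedFDeriv_fun_zero, Pi.zero_apply, norm_zero]
    positivity

end Bump

/-! ### The derivative of a synchronization at a point that is not periodic -/

section Taylor

theorem norm_sub_sub_fderiv_le_of_iteratedFDeriv_two {E F : Type*} [NormedAddCommGroup E]
    [NormedSpace ℝ E] [NormedAddCommGroup F] [NormedSpace ℝ F] {f : E → F} {U : Set E}
    (hU : IsOpen U) (hf : ContDiffOn ℝ 2 f U) {x z : E} {B r : ℝ} (hr : Metric.closedBall x r ⊆ U)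
    (hB : ∀ y ∈ Metric.closedBall x r, ‖iteratedFDeriv ℝ 2 f y‖ ≤ B) (hz : ‖z - x‖ ≤ r) :
    ‖f z - f x - fderiv ℝ f x (z - x)‖ ≤ B * ‖z - x‖ ^ 2 := by
  have hsub : Metric.closedBall x ‖z - x‖ ⊆ Metric.closedBall x r :=
    Metric.closedBall_subset_closedBall hz
  have hxs : x ∈ Metric.closedBall x ‖z - x‖ := Metric.mem_closedBall_self (norm_nonneg _)
  have hzs : z ∈ Metric.closedBall x ‖z - x‖ := by simp [dist_eq_norm]
  have hB0 : 0 ≤ B := (norm_nonneg _).trans (hB x (hsub hxs))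
  have hd : ∀ y ∈ Metric.closedBall x ‖z - x‖, DifferentiableAt ℝ f y := fun y hy =>
    (hf.contDiffAt (hU.mem_nhds (hr (hsub hy)))).differentiableAt two_ne_zero
  have hd2 : ∀ y ∈ Metric.closedBall x ‖z - x‖, DifferentiableAt ℝ (fderiv ℝ f) y := fun y hy =>
    ((hf.contDiffAt (hU.mem_nhds (hr (hsub hy)))).fderiv_right (m := 1)
      (by norm_num)).differentiableAt one_ne_zero
  have hlip : ∀ y ∈ Metric.closedBall x ‖z - x‖, ‖fderiv ℝ f y - fderiv ℝ f x‖ ≤ B * ‖z - x‖ := by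
    intro y hy
    refine ((convex_closedBall x ‖z - x‖).norm_image_sub_le_of_norm_fderiv_le (C := B) hd2
      (fun w hw => ?_) hxs hy).trans ?_
    · have := hB w (hsub hw)
      rwa [← norm_iteratedFDeriv_fderiv, ← norm_iteratedFDeriv_fderiv, norm_iteratedFDeriv_zero]
        at this
    · gcongr
      simpa [dist_eq_norm] using hy
  calc _ ≤ B * ‖z - x‖ * ‖z - x‖ :=
        (convex_closedBall x ‖z - x‖).norm_image_sub_le_of_norm_fderiv_le' hd hlip hxs hzs
    _ = _ := by ring

end Taylor

theorem eventually_nhdsGT_zero_mul_le (c : ℝ) {t : ℝ} (ht : 0 < t) :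
    ∀ᶠ δ in 𝓝[>] (0 : ℝ), c * δ ≤ t := by
  have : Tendsto (fun δ : ℝ => c * δ) (𝓝[>] 0) (𝓝 0) := by
    simpa using ((continuous_const_mul c).tendsto 0).mono_left nhdsWithin_le_nhds
  exact (this.eventually_lt_const ht).mono fun _ h => h.le

section Iterate

variable {q : ℕ} {M : Type*} [TopologicalSpace M] [ChartedSpace (EuclideanSpace ℝ (Fin q)) M]

theorem contMDiff_iterate_symm (φ : M ≃ₘ^2⟮𝓡 q, 𝓡 q⟯ M) (j : ℕ) :
    ContMDiff (𝓡 q) (𝓡 q) 2 (φ.symm^[j]) := by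
  induction j with
  | zero => exact contMDiff_id
  | succ j ih => exact ih.comp φ.symm.contMDiff

theorem mfderiv_iterate_symm_bijective [IsManifold (𝓡 q) ∞ M] (φ : M ≃ₘ^2⟮𝓡 q, 𝓡 q⟯ M) (j : ℕ)
    (m : M) : Function.Bijective (mfderiv (𝓡 q) (𝓡 q) (φ.symm^[j]) m) := by
  induction j generalizing m with
  | zero =>
    have : mfderiv (𝓡 q) (𝓡 q) (φ.symm^[0]) m =
        ContinuousLinearMap.id ℝ (TangentSpace (𝓡 q) m) := mfderiv_id
    rw [this]
    exact Function.bijective_id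
  | succ j ih =>
    have h1 := (contMDiff_iterate_symm φ j).mdifferentiable two_ne_zero
    have h2 := φ.symm.mdifferentiable two_ne_zero
    have h3 := (φ.symm.toOpenPartialHomeomorph_mdifferentiable two_ne_zero).mfderiv_bijective
      (mem_univ m)
    rw [Function.iterate_succ, mfderiv_comp m (h1 _) (h2 m)]
    exact (ih _).comp h3

theorem hasFDerivAt_chart_comp_iterate_symm [IsManifold (𝓡 q) ∞ M] (φ : M ≃ₘ^2⟮𝓡 q, 𝓡 q⟯ M)
    (i : ℕ) (m : M) :
    HasFDerivAt (fun z => chartAt (EuclideanSpace ℝ (Fin q)) (φ.symm^[i] m)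
        (φ.symm^[i] ((chartAt (EuclideanSpace ℝ (Fin q)) m).symm z)))
      (chartDeriv (chartAt (EuclideanSpace ℝ (Fin q)) m)
        (chartAt (EuclideanSpace ℝ (Fin q)) (φ.symm^[i] m) ∘ φ.symm^[i]) m)
      (chartAt (EuclideanSpace ℝ (Fin q)) m m) := by
  set ψ := chartAt (EuclideanSpace ℝ (Fin q)) m
  set χ := chartAt (EuclideanSpace ℝ (Fin q)) (φ.symm^[i] m)
  have hψm : ψ.symm (ψ m) = m := ψ.left_inv (mem_chart_source _ m)
  have h2 : MDifferentiableAt (𝓡 q) (𝓡 q) ψ.symm (ψ m) :=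
    mdifferentiableAt_atlas_symm (chart_mem_atlas _ _) (ψ.map_source (mem_chart_source _ m))
  have h3 : MDifferentiableAt (𝓡 q) (𝓡 q) (φ.symm^[i]) (ψ.symm (ψ m)) :=
    (contMDiff_iterate_symm φ i).mdifferentiable two_ne_zero _
  have h4 : MDifferentiableAt (𝓡 q) (𝓡 q) χ ((φ.symm^[i] ∘ ψ.symm) (ψ m)) := by
    rw [Function.comp_apply, hψm]
    exact mdifferentiableAt_atlas (chart_mem_atlas _ _) (mem_chart_source _ _)
  exact (h4.comp (ψ m) (h3.comp (ψ m) h2)).differentiableAt.hasFDerivAt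

/-- Every covector at `m` is the pullback under `φ⁻ⁱ` of a covector at `φ⁻ⁱ m`. -/
theorem exists_comp_chartDeriv_eq [IsManifold (𝓡 q) ∞ M] (φ : M ≃ₘ^2⟮𝓡 q, 𝓡 q⟯ M) (i : ℕ) (m : M)
    (ζ : EuclideanSpace ℝ (Fin q) →L[ℝ] ℝ) :
    ∃ ξ : EuclideanSpace ℝ (Fin q) →L[ℝ] ℝ,
      ξ.comp (chartDeriv (chartAt (EuclideanSpace ℝ (Fin q)) m)
        (chartAt (EuclideanSpace ℝ (Fin q)) (φ.symm^[i] m) ∘ φ.symm^[i]) m) = ζ := by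
  have hd : MDifferentiableAt (𝓡 q) (𝓡 q) (chartAt (EuclideanSpace ℝ (Fin q)) (φ.symm^[i] m))
      (φ.symm^[i] m) := mdifferentiableAt_atlas (chart_mem_atlas _ _) (mem_chart_source _ _)
  have hd' : MDifferentiableAt (𝓡 q) (𝓡 q) (φ.symm^[i]) m :=
    (contMDiff_iterate_symm φ i).mdifferentiable two_ne_zero m
  set D := chartDeriv (chartAt (EuclideanSpace ℝ (Fin q)) m)
    (chartAt (EuclideanSpace ℝ (Fin q)) (φ.symm^[i] m) ∘ φ.symm^[i]) m with hD
  have hinj : Function.Injective D := by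
    rw [hD, ← mfderiv_injective_iff_chartDeriv (hd.comp m hd') (mem_chart_source _ m),
      mfderiv_comp m hd hd']
    exact ((mdifferentiable_chart _).mfderiv_injective (mem_chart_source _ _)).comp
      (mfderiv_iterate_symm_bijective φ i m).1
  let e := (LinearEquiv.ofInjectiveEndo D.toLinearMap hinj).toContinuousLinearEquiv
  refine ⟨ζ.comp (e.symm : EuclideanSpace ℝ (Fin q) →L[ℝ] EuclideanSpace ℝ (Fin q)), ?_⟩
  ext1 v
  exact congrArg ζ (e.symm_apply_apply v)

end Iterate

theorem isPeriodicPt_of_iterate_symm_eq {M : Type*} {φ : Equiv.Perm M} {m : M} {j k : ℕ}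
    (hjk : j < k) (h : φ.symm^[j] m = φ.symm^[k] m) : Function.IsPeriodicPt φ (k - j) m := by
  have h1 := congrArg (φ^[k]) h
  rw [φ.rightInverse_symm.iterate k m, ← Nat.sub_add_cancel hjk.le, Function.iterate_add_apply,
    φ.rightInverse_symm.iterate j m] at h1
  exact h1

theorem iterate_symm_injective_of_notMem_periodicPts {M : Type*} {φ : Equiv.Perm M} {m : M}
    (hm : m ∉ Function.periodicPts φ) : Function.Injective fun j : ℕ => φ.symm^[j] m := by
  have key (j k : ℕ) (hjk : j < k) : φ.symm^[j] m ≠ φ.symm^[k] m := fun h => hm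
    (Function.mk_mem_periodicPts (Nat.sub_pos_of_lt hjk) (isPeriodicPt_of_iterate_symm_eq hjk h))
  intro j k h
  by_contra hne
  rcases Nat.lt_or_gt_of_ne hne with h' | h'
  · exact key j k h' h
  · exact key k j h' h.symm

section Nonperiodic

variable {q N : ℕ} {M : Type*} [TopologicalSpace M] [ChartedSpace (EuclideanSpace ℝ (Fin q)) M]
  [IsManifold (𝓡 q) ∞ M] [T2Space M] [CompactSpace M]
  {φ : M ≃ₘ^2⟮𝓡 q, 𝓡 q⟯ M} {A : Matrix (Fin N) (Fin N) ℝ} {C : Fin N → ℝ}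
  {T : C^2⟮𝓡 q, M; 𝓘(ℝ, ℝ), ℝ⟯ →ₗ[ℝ] C^2⟮𝓡 q, M; 𝓘(ℝ, Fin N → ℝ), Fin N → ℝ⟯}

/-- At a point `m` that is not periodic, and for every covector `ξ` at `φ⁻ⁱ m`, the derivatives of
synchronizations approximate the pullback of `ξ` under `φ⁻ⁱ` times the vector `A ^ i C`. The
observations are the cut-off linear functions at scale `ε`. The derivative is compared with the
difference quotient of step `δ ε`: Taylor's formula costs `O(δ)`, because the second derivative is
`O(1 / ε)` by continuity of `T`; the terms of index `j ≠ i`, `j < L`, vanish for small `ε`; and the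
rest of the series contributes `O(‖A ^ L‖ / δ)`. -/
theorem exists_norm_chartDeriv_sub_le
    (hρ : spectralRadius ℂ (toComplexMatrix A) < 1)
    (hT : ∀ obs : C^2⟮𝓡 q, M; 𝓘(ℝ, ℝ), ℝ⟯,
      IsGeneralizedSynchronization φ.toEquiv obs (linearStateMap A C) (T obs))
    (hTc : Continuous T) {m : M} (hm : m ∉ Function.periodicPts φ) (i : ℕ)
    (ξ : EuclideanSpace ℝ (Fin q) →L[ℝ] ℝ) {e : ℝ} (he : 0 < e) :
    ∃ obs, ‖chartDeriv (chartAt (EuclideanSpace ℝ (Fin q)) m) (T obs) m -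
      (ξ.comp (chartDeriv (chartAt (EuclideanSpace ℝ (Fin q)) m)
        (chartAt (EuclideanSpace ℝ (Fin q)) (φ.symm^[i] m) ∘ φ.symm^[i]) m)).smulRight
        ((A ^ i).mulVec C)‖ ≤ e := by
  set ψ := chartAt (EuclideanSpace ℝ (Fin q)) m with hψ
  set p := φ.symm^[i] m with hp
  set χ := chartAt (EuclideanSpace ℝ (Fin q)) p with hχ
  set a := (A ^ i).mulVec C with ha
  set x₀ := ψ m with hx₀
  set D := chartDeriv ψ (χ ∘ φ.symm^[i]) m with hD
  have hmψ : m ∈ ψ.source := mem_chart_source _ m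
  have hx₀t : x₀ ∈ ψ.target := ψ.map_source hmψ
  have hψm : ψ.symm x₀ = m := ψ.left_inv hmψ
  have hpχ : p ∈ χ.source := mem_chart_source _ p
  -- radii of balls in the two charts
  obtain ⟨r, hr0, hr⟩ := Metric.nhds_basis_closedBall.mem_iff.1 (ψ.open_target.mem_nhds hx₀t)
  obtain ⟨R', hR'0, hR'⟩ := Metric.nhds_basis_closedBall.mem_iff.1
    (χ.open_target.mem_nhds (χ.map_source hpχ))
  set R := min 1 (R' / 2) with hR
  have hR0 : 0 < R := by positivity
  have hRt : Metric.closedBall (χ p) (2 * R) ⊆ χ.target :=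
    (Metric.closedBall_subset_closedBall (by linarith [min_le_right 1 (R' / 2)])).trans hR'
  -- second derivatives and sup norms of the synchronizations of the rescaled bumps
  obtain ⟨B₂, hB₂⟩ := (uniformlyBounded_linearBump p ξ (min_le_left _ _) hRt).map T hTc ψ
    (IsManifold.chart_mem_maximalAtlas m) 2 le_rfl _ hr (isCompact_closedBall _ _)
  obtain ⟨B₀, hB₀0, hB₀⟩ := IsGeneralizedSynchronization.exists_norm_le hρ φ.toEquiv C
  -- the chart representative of `φ⁻ⁱ`
  have hcont (j : ℕ) : ContinuousAt (fun z => φ.symm^[j] (ψ.symm z)) x₀ :=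
    (contMDiff_iterate_symm φ j).continuous.continuousAt.comp (ψ.continuousAt_symm hx₀t)
  have hDd : HasFDerivAt (fun z => χ (φ.symm^[i] (ψ.symm z))) D x₀ :=
    hasFDerivAt_chart_comp_iterate_symm φ i m
  -- the constants: `δ` is the ratio of the step of the difference quotient to the size of the bump
  obtain ⟨δ, hδ0, hδ1, hδD, hδe⟩ : ∃ δ : ℝ, 0 < δ ∧ δ ≤ 1 ∧ (‖D‖ + 1) * δ ≤ 1 ∧ B₂ * δ ≤ e / 3 := by
    obtain ⟨δ, ⟨⟨h1, h2⟩, h3⟩, h4⟩ := ((((eventually_nhdsGT_zero_mul_le 1 one_pos).and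
      (eventually_nhdsGT_zero_mul_le (‖D‖ + 1) one_pos)).and
      (eventually_nhdsGT_zero_mul_le B₂ (by positivity : 0 < e / 3))).and
      self_mem_nhdsWithin).exists
    exact ⟨δ, h4, by simpa using h1, h2, h3⟩
  -- `κ` bounds the norm of `A ^ L`, so that the rest of the series is small against `δ`
  obtain ⟨κ, hκ0, hκ⟩ : ∃ κ : ℝ, 0 < κ ∧ κ * (B₀ * (2 * ‖ξ‖)) * 2 ≤ e / 3 * δ := by
    obtain ⟨κ, h1, h2⟩ := ((eventually_nhdsGT_zero_mul_le (B₀ * (2 * ‖ξ‖) * 2)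
      (by positivity : 0 < e / 3 * δ)).and self_mem_nhdsWithin).exists
    exact ⟨κ, h2, by linarith⟩
  -- `η` is the error in the first-order expansion of `φ⁻ⁱ` at `m`
  obtain ⟨η, hη0, hη1, hη⟩ : ∃ η : ℝ, 0 < η ∧ η ≤ 1 ∧ ‖ξ‖ * η * ‖a‖ ≤ e / 3 := by
    obtain ⟨η, ⟨h1, h2⟩, h3⟩ := (((eventually_nhdsGT_zero_mul_le (‖ξ‖ * ‖a‖)
      (by positivity : 0 < e / 3)).and (eventually_nhdsGT_zero_mul_le 1 one_pos)).and
      self_mem_nhdsWithin).exists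
    exact ⟨η, h3, by simpa using h2, by linarith⟩
  obtain ⟨L, hL, hiL⟩ := ((eventually_norm_pow_mulVec_le hρ hκ0).and (eventually_gt_atTop i)).exists
  have hev1 : ∀ᶠ z in 𝓝 x₀, ‖z - x₀‖ ≤ r ∧ φ.symm^[i] (ψ.symm z) ∈ χ.source ∧
      ‖χ (φ.symm^[i] (ψ.symm z)) - χ p - D (z - x₀)‖ ≤ η * ‖z - x₀‖ := by
    refine Filter.Eventually.and ?_ (Filter.Eventually.and ?_ ?_)
    · filter_upwards [Metric.closedBall_mem_nhds x₀ hr0] with z hz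
      simpa [dist_eq_norm] using hz
    · refine (hcont i).eventually (χ.open_source.mem_nhds ?_)
      change φ.symm^[i] (ψ.symm x₀) ∈ χ.source
      rwa [hψm]
    · simpa only [hψm] using hDd.isLittleO.def hη0
  -- near `m` and `p`, only the `i`-th iterate leads from one to the other
  have hev2 : ∀ᶠ w : EuclideanSpace ℝ (Fin q) × EuclideanSpace ℝ (Fin q) in 𝓝 (x₀, χ p),
      ∀ j ∈ (Finset.range L).erase i, χ.symm w.2 ≠ φ.symm^[j] (ψ.symm w.1) := by
    rw [Filter.eventually_all_finset]
    intro j hj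
    have h1 : Tendsto (fun w : EuclideanSpace ℝ (Fin q) × EuclideanSpace ℝ (Fin q) => χ.symm w.2)
        (𝓝 (x₀, χ p)) (𝓝 p) := by
      have := (χ.continuousAt_symm (χ.map_source hpχ)).tendsto.comp
        (continuous_snd.tendsto (x₀, χ p))
      rwa [χ.left_inv hpχ] at this
    have h2 : Tendsto (fun w : EuclideanSpace ℝ (Fin q) × EuclideanSpace ℝ (Fin q) =>
        φ.symm^[j] (ψ.symm w.1)) (𝓝 (x₀, χ p)) (𝓝 (φ.symm^[j] m)) := by
      have := (hcont j).tendsto.comp (continuous_fst.tendsto (x₀, χ p))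
      rwa [hψm] at this
    refine (h1.prodMk_nhds h2).eventually (isClosed_diagonal.isOpen_compl.mem_nhds ?_)
    refine fun h => (Finset.mem_erase.1 hj).1 ?_
    exact (iterate_symm_injective_of_notMem_periodicPts (φ := φ.toEquiv) hm h).symm
  obtain ⟨ρ₁, hρ₁0, hρ₁⟩ := Metric.eventually_nhds_iff.1 hev1
  obtain ⟨ρ₂, hρ₂0, hρ₂⟩ := Metric.eventually_nhds_iff.1 hev2
  obtain ⟨ε, hε0, hεR, hερ₁, hερ₂⟩ : ∃ ε : ℝ, 0 < ε ∧ ε ≤ R ∧ ε < ρ₁ ∧ 2 * ε < ρ₂ := by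
    refine ⟨min R (min (ρ₁ / 2) (ρ₂ / 4)), by positivity, min_le_left _ _, ?_, ?_⟩
    · linarith [min_le_right R (min (ρ₁ / 2) (ρ₂ / 4)), min_le_left (ρ₁ / 2) (ρ₂ / 4)]
    · linarith [min_le_right R (min (ρ₁ / 2) (ρ₂ / 4)), min_le_right (ρ₁ / 2) (ρ₂ / 4)]
  let b : SmoothBumpFunction (𝓡 q) p :=
    ⟨⟨ε, 2 * ε, hε0, by linarith⟩, by
      intro y hy
      have h1 : y ∈ Metric.closedBall (χ p) (2 * R) :=
        Metric.closedBall_subset_closedBall (by linarith) hy.1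
      simpa using hRt h1⟩
  set g := T (linearBump b ξ) with hg
  -- within distance `δ ε` of `m`, the observation is linear on the `i`-th iterate and vanishes on
  -- the other ones
  have hexp : ∀ z, ‖z - x₀‖ ≤ δ * ε → g (ψ.symm z) = ξ (χ (φ.symm^[i] (ψ.symm z)) - χ p) • a +
      (A ^ L).mulVec (g (φ.symm^[L] (ψ.symm z))) := by
    intro z hz
    have hzε : ‖z - x₀‖ ≤ ε := hz.trans (mul_le_of_le_one_left hε0.le hδ1)
    obtain ⟨-, hs, hd⟩ := hρ₁ (y := z) (by rw [dist_eq_norm]; linarith)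
    have hdist : dist (χ (φ.symm^[i] (ψ.symm z))) (χ p) ≤ ε := by
      rw [dist_eq_norm]
      calc ‖χ (φ.symm^[i] (ψ.symm z)) - χ p‖
          ≤ ‖χ (φ.symm^[i] (ψ.symm z)) - χ p - D (z - x₀)‖ + ‖D (z - x₀)‖ := by
            simpa using norm_add_le (χ (φ.symm^[i] (ψ.symm z)) - χ p - D (z - x₀)) (D (z - x₀))
        _ ≤ 1 * ‖z - x₀‖ + ‖D‖ * ‖z - x₀‖ := by
            refine add_le_add (hd.trans ?_) (D.le_opNorm _)
            gcongr
        _ = (‖D‖ + 1) * ‖z - x₀‖ := by ring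
        _ ≤ (‖D‖ + 1) * (δ * ε) := by gcongr
        _ = (‖D‖ + 1) * δ * ε := by ring
        _ ≤ ε := mul_le_of_le_one_left hε0.le hδD
    rw [hg, (hT (linearBump b ξ)).apply_eq_sum L (ψ.symm z)]
    congr 1
    rw [Finset.sum_eq_single_of_mem i (Finset.mem_range.2 hiL)]
    · rw [← linearBump_of_dist_le (b := b) (ξ := ξ) hs hdist]
      rfl
    · intro j hj hji
      have : linearBump b ξ (φ.symm^[j] (ψ.symm z)) = 0 := by
        by_contra hne
        obtain ⟨h1, h2⟩ := mem_of_linearBump_ne_zero hne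
        have h2' : dist (χ (φ.symm^[j] (ψ.symm z))) (χ p) < 2 * ε := h2
        refine hρ₂ (y := (z, χ (φ.symm^[j] (ψ.symm z)))) ?_ j (Finset.mem_erase.2 ⟨hji, hj⟩)
          (χ.left_inv h1)
        rw [Prod.dist_eq, max_lt_iff]
        exact ⟨by rw [dist_eq_norm]; linarith, by linarith⟩
      exact smul_eq_zero_of_left this _
  have hsup : ∀ y, ‖g y‖ ≤ B₀ * (2 * ‖ξ‖) * ε := by
    intro y
    have h1 := hB₀ _ _ _ (hT (linearBump b ξ)) (isCompact_range g.contMDiff.continuous).isBounded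
      (fun m => abs_linearBump_le (b := b) (ξ := ξ)) y
    refine h1.trans (le_of_eq ?_)
    change B₀ * (‖ξ‖ * (2 * ε)) = _
    ring
  have htaylor : ∀ z, ‖z - x₀‖ ≤ r →
      ‖g (ψ.symm z) - g m - chartDeriv ψ g m (z - x₀)‖ ≤ B₂ / ε * ‖z - x₀‖ ^ 2 := by
    intro z hz
    have h1 := norm_sub_sub_fderiv_le_of_iteratedFDeriv_two ψ.open_target
      (g.contDiffOn_comp_symm (IsManifold.chart_mem_maximalAtlas m)) hr (B := B₂ / ε)
      (fun y hy => ?_) hz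
    · change ‖g (ψ.symm z) - g (ψ.symm x₀) - chartDeriv ψ g m (z - x₀)‖ ≤ _ at h1
      rwa [hψm] at h1
    · have h2 := hB₂ ⟨b, rfl, hεR⟩ y hy
      simp only [map_smul] at h2
      rw [ContMDiffMap.eqOn_iteratedFDeriv_smul _ _ (IsManifold.chart_mem_maximalAtlas m) le_rfl
        (hr hy), Pi.smul_apply, norm_smul, Real.norm_of_nonneg hε0.le] at h2
      rwa [le_div_iff₀ hε0, mul_comm]
  refine ⟨linearBump b ξ, ContinuousLinearMap.opNorm_le_of_unit_norm he.le fun u hu => ?_⟩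
  set h := δ * ε with hh
  have hh0 : 0 < h := mul_pos hδ0 hε0
  set z := x₀ + h • u with hz
  have hzx : z - x₀ = h • u := by rw [hz]; abel
  have hzn : ‖z - x₀‖ = h := by rw [hzx, norm_smul, hu, mul_one, Real.norm_of_nonneg hh0.le]
  have hzρ : dist z x₀ < ρ₁ := by
    rw [dist_eq_norm, hzn]
    exact (mul_le_of_le_one_left hε0.le hδ1).trans_lt hερ₁
  obtain ⟨hzr, -, hzd⟩ := hρ₁ hzρ
  have e1 := hexp z hzn.le
  have e0 := hexp x₀ (by simpa using hh0.le)
  rw [hψm, ← hp, sub_self, map_zero, zero_smul, zero_add] at e0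
  have e2 := htaylor z hzr
  have key : h • ((chartDeriv ψ g m - (ξ.comp D).smulRight a) u) =
      -(g (ψ.symm z) - g m - chartDeriv ψ g m (z - x₀)) +
      ξ (χ (φ.symm^[i] (ψ.symm z)) - χ p - D (z - x₀)) • a +
      ((A ^ L).mulVec (g (φ.symm^[L] (ψ.symm z))) - (A ^ L).mulVec (g (φ.symm^[L] m))) := by
    rw [e1, e0, hzx]
    simp only [map_sub, map_smul, sub_apply,
      ContinuousLinearMap.smulRight_apply, ContinuousLinearMap.comp_apply, smul_eq_mul]
    module
  have hbound : h * ‖(chartDeriv ψ g m - (ξ.comp D).smulRight a) u‖ ≤ h * e := by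
    rw [← Real.norm_of_nonneg hh0.le, ← norm_smul, key, Real.norm_of_nonneg hh0.le]
    have n1 : ‖-(g (ψ.symm z) - g m - chartDeriv ψ g m (z - x₀))‖ ≤ h * (e / 3) := by
      rw [norm_neg]
      refine e2.trans ?_
      rw [hzn]
      calc B₂ / ε * h ^ 2 = h * (B₂ * δ) := by rw [hh]; field_simp
        _ ≤ h * (e / 3) := by gcongr
    have n2 : ‖ξ (χ (φ.symm^[i] (ψ.symm z)) - χ p - D (z - x₀)) • a‖ ≤ h * (e / 3) := by
      rw [norm_smul]
      calc _ ≤ (‖ξ‖ * (η * ‖z - x₀‖)) * ‖a‖ := by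
            gcongr
            exact (ξ.le_opNorm _).trans (by gcongr)
        _ = h * (‖ξ‖ * η * ‖a‖) := by rw [hzn]; ring
        _ ≤ h * (e / 3) := by gcongr
    have n3 : ‖(A ^ L).mulVec (g (φ.symm^[L] (ψ.symm z))) - (A ^ L).mulVec (g (φ.symm^[L] m))‖ ≤
        h * (e / 3) := by
      have hs (y : M) : ‖(A ^ L).mulVec (g y)‖ ≤ κ * (B₀ * (2 * ‖ξ‖) * ε) :=
        (hL _).trans (by gcongr; exact hsup y)
      calc _ ≤ κ * (B₀ * (2 * ‖ξ‖) * ε) + κ * (B₀ * (2 * ‖ξ‖) * ε) :=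
            (norm_sub_le _ _).trans (add_le_add (hs _) (hs _))
        _ = κ * (B₀ * (2 * ‖ξ‖)) * 2 * ε := by ring
        _ ≤ e / 3 * δ * ε := by gcongr
        _ = h * (e / 3) := by rw [hh]; ring
    calc _ ≤ h * (e / 3) + h * (e / 3) + h * (e / 3) :=
          (norm_add_le _ _).trans (add_le_add ((norm_add_le _ _).trans (add_le_add n1 n2)) n3)
      _ = h * e := by ring
  exact le_of_mul_le_mul_left hbound hh0

end Nonperiodic

section Surjective

variable {q : ℕ} {M : Type*} [TopologicalSpace M] [ChartedSpace (EuclideanSpace ℝ (Fin q)) M]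
  {V : Type*} [NormedAddCommGroup V] [NormedSpace ℝ V]

/-- `chartDeriv ψ g x` as a linear function of `g`. -/
noncomputable def chartDerivLinear {ψ : OpenPartialHomeomorph M (EuclideanSpace ℝ (Fin q))}
    (hψ : ψ ∈ IsManifold.maximalAtlas (𝓡 q) ∞ M) {x : M} (hx : x ∈ ψ.source) :
    C^2⟮𝓡 q, M; 𝓘(ℝ, V), V⟯ →ₗ[ℝ] EuclideanSpace ℝ (Fin q) →L[ℝ] V :=
  have hd (g : C^2⟮𝓡 q, M; 𝓘(ℝ, V), V⟯) : DifferentiableAt ℝ (g ∘ ψ.symm) (ψ x) :=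
    ((g.contDiffOn_comp_symm hψ).contDiffAt
      (ψ.open_target.mem_nhds (ψ.map_source hx))).differentiableAt two_ne_zero
  { toFun := fun g => chartDeriv ψ g x
    map_add' := fun f g => fderiv_add (hd f) (hd g)
    map_smul' := fun c g => fderiv_const_smul (hd g) c }

/-- At a point that is not periodic, every linear map is the derivative of a synchronization: the
range of `obs ↦ D_m (T obs)` is a closed subspace that contains all rank-one maps `ζ ⊗ A ^ i C` by
`exists_norm_chartDeriv_sub_le`. -/
theorem exists_chartDeriv_eq {N : ℕ} [IsManifold (𝓡 q) ∞ M] [T2Space M] [CompactSpace M]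
    {φ : M ≃ₘ^2⟮𝓡 q, 𝓡 q⟯ M} {A : Matrix (Fin N) (Fin N) ℝ} {C : Fin N → ℝ}
    {T : C^2⟮𝓡 q, M; 𝓘(ℝ, ℝ), ℝ⟯ →ₗ[ℝ] C^2⟮𝓡 q, M; 𝓘(ℝ, Fin N → ℝ), Fin N → ℝ⟯}
    (hρ : spectralRadius ℂ (toComplexMatrix A) < 1)
    (hT : ∀ obs : C^2⟮𝓡 q, M; 𝓘(ℝ, ℝ), ℝ⟯,
      IsGeneralizedSynchronization φ.toEquiv obs (linearStateMap A C) (T obs))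
    (hTc : Continuous T)
    (h_krylov : LinearIndependent ℝ (fun j : Fin N => (A ^ (j : ℕ)).mulVec C))
    {m : M} (hm : m ∉ Function.periodicPts φ) (S : EuclideanSpace ℝ (Fin q) →L[ℝ] (Fin N → ℝ)) :
    ∃ obs, chartDeriv (chartAt (EuclideanSpace ℝ (Fin q)) m) (T obs) m = S := by
  have hmA : chartAt (EuclideanSpace ℝ (Fin q)) m ∈ IsManifold.maximalAtlas (𝓡 q) ∞ M :=
    IsManifold.chart_mem_maximalAtlas m
  set J := (chartDerivLinear (V := Fin N → ℝ) hmA (mem_chart_source _ m)).comp T with hJ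
  suffices h : S ∈ LinearMap.range J from h
  have h1 (i : ℕ) (ζ : EuclideanSpace ℝ (Fin q) →L[ℝ] ℝ) :
      ζ.smulRight ((A ^ i).mulVec C) ∈ LinearMap.range J := by
    obtain ⟨ξ, hξ⟩ := exists_comp_chartDeriv_eq φ i m ζ
    rw [← SetLike.mem_coe, ← (Submodule.closed_of_finiteDimensional _).closure_eq,
      Metric.mem_closure_iff]
    intro ε hε
    obtain ⟨obs, hobs⟩ := exists_norm_chartDeriv_sub_le hρ hT hTc hm i ξ (half_pos hε)
    rw [hξ] at hobs
    refine ⟨J obs, ⟨obs, rfl⟩, ?_⟩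
    rw [dist_comm, dist_eq_norm]
    exact hobs.trans_lt (half_lt_self hε)
  have h2 (ζ : EuclideanSpace ℝ (Fin q) →L[ℝ] ℝ) (w : Fin N → ℝ) :
      ζ.smulRight w ∈ LinearMap.range J := by
    have hw : w ∈ Submodule.span ℝ (range fun j : Fin N => (A ^ (j : ℕ)).mulVec C) := by
      rw [h_krylov.span_eq_top_of_card_eq_finrank' (by simp)]
      trivial
    induction hw using Submodule.span_induction with
    | mem w hw =>
      obtain ⟨j, rfl⟩ := hw
      exact h1 j ζ
    | zero => simp
    | add v w _ _ hv hw =>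
      have : ζ.smulRight (v + w) = ζ.smulRight v + ζ.smulRight w := by ext1; simp
      rw [this]
      exact add_mem hv hw
    | smul c w _ hw =>
      have : ζ.smulRight (c • w) = c • ζ.smulRight w := by ext1; simp [smul_comm c]
      rw [this]
      exact Submodule.smul_mem _ c hw
  have h3 : S = ∑ k, (EuclideanSpace.proj k : EuclideanSpace ℝ (Fin q) →L[ℝ] ℝ).smulRight
      (S (EuclideanSpace.single k 1)) := by
    ext1 v
    conv_lhs => rw [← (EuclideanSpace.basisFun (Fin q) ℝ).sum_repr v]
    simp
  rw [h3]
  exact sum_mem fun k _ => h2 _ _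

end Surjective

/-! ### Transversality -/

section Transversality

open Module

theorem finrank_continuousLinearMap_euclideanSpace_pi (q N : ℕ) :
    finrank ℝ (EuclideanSpace ℝ (Fin q) →L[ℝ] (Fin N → ℝ)) = q * N := by
  rw [← (LinearMap.toContinuousLinearMap (𝕜 := ℝ) (E := EuclideanSpace ℝ (Fin q))
    (F' := Fin N → ℝ)).finrank_eq, finrank_linearMap]
  simp

/-- The linear map whose columns other than the `a`-th are `w`, and whose `a`-th column is the
combination of the other ones with coefficients `v`. -/
noncomputable def dependentColumns {q N : ℕ} (a : Fin (q + 1)) (v : Fin q → ℝ)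
    (w : Fin q → Fin N → ℝ) : EuclideanSpace ℝ (Fin (q + 1)) →L[ℝ] (Fin N → ℝ) :=
  ContinuousLinearMap.smulRightL ℝ _ _ (EuclideanSpace.proj a) (∑ b, v b • w b) +
    ∑ b, ContinuousLinearMap.smulRightL ℝ _ _ (EuclideanSpace.proj (a.succAbove b)) (w b)

/-- A matrix with dependent columns has a column that is a combination of the other ones. -/
theorem exists_eq_dependentColumns {q N : ℕ}
    {S : EuclideanSpace ℝ (Fin (q + 1)) →L[ℝ] (Fin N → ℝ)} (hS : ¬Function.Injective S) :
    ∃ a v w, S = dependentColumns a v w := by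
  rw [injective_iff_map_eq_zero] at hS
  push Not at hS
  obtain ⟨u, hu, hu0⟩ := hS
  obtain ⟨a, ha⟩ : ∃ a, u a ≠ 0 := by
    by_contra! h
    exact hu0 (by ext a; simpa using h a)
  have hsum (z : EuclideanSpace ℝ (Fin (q + 1))) : S z = z a • S (EuclideanSpace.single a 1) +
      ∑ b, z (a.succAbove b) • S (EuclideanSpace.single (a.succAbove b) 1) := by
    conv_lhs => rw [← (EuclideanSpace.basisFun (Fin (q + 1)) ℝ).sum_repr z]
    rw [Fin.sum_univ_succAbove _ a]
    simp
  refine ⟨a, fun b => -(u a)⁻¹ * u (a.succAbove b),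
    fun b => S (EuclideanSpace.single (a.succAbove b) 1), ?_⟩
  have h1 : S (EuclideanSpace.single a 1) =
      ∑ b, (-(u a)⁻¹ * u (a.succAbove b)) • S (EuclideanSpace.single (a.succAbove b) 1) := by
    rw [hsum u] at hu
    have h2 := congrArg (fun y => (u a)⁻¹ • y) (eq_neg_of_add_eq_zero_left hu)
    simp only [smul_smul, inv_mul_cancel₀ ha, one_smul] at h2
    rw [h2, smul_neg, Finset.smul_sum, ← Finset.sum_neg_distrib]
    exact Finset.sum_congr rfl fun b _ => by rw [smul_smul, neg_mul, neg_smul]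
  ext1 z
  rw [hsum z, h1]
  simp [dependentColumns]

theorem contDiff_dependentColumns {q N : ℕ} (a : Fin (q + 1)) :
    ContDiff ℝ 1 fun p : (Fin q → ℝ) × (Fin q → Fin N → ℝ) => dependentColumns a p.1 p.2 := by
  unfold dependentColumns
  fun_prop

/-- For a `C¹` family of affine maps `s ↦ G x + L x s` of the space of linear maps `ℝ ^ q → ℝ ^ N`,
with invertible linear parts, a dense set of parameters `s` gives injective maps for all `x`. The
bad parameters are `(L x)⁻¹ (S - G x)` with `S` not injective, and `S` has `q - 1` free columns and
`q - 1` coefficients, so the bad set has dimension at most `q + (q - 1) + (q - 1) N < q N`. -/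
theorem dense_setOf_injective_add {q N : ℕ} (hN : 2 * q ≤ N) {U : Set (EuclideanSpace ℝ (Fin q))}
    (hU : Convex ℝ U)
    {G : EuclideanSpace ℝ (Fin q) → EuclideanSpace ℝ (Fin q) →L[ℝ] (Fin N → ℝ)}
    (hG : ContDiffOn ℝ 1 G U)
    {L : EuclideanSpace ℝ (Fin q) → (EuclideanSpace ℝ (Fin q) →L[ℝ] (Fin N → ℝ)) →L[ℝ]
      EuclideanSpace ℝ (Fin q) →L[ℝ] (Fin N → ℝ)}
    (hL : ContDiffOn ℝ 1 L U) (hLu : ∀ x ∈ U, IsUnit (L x)) :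
    Dense {s | ∀ x ∈ U, Function.Injective (G x + L x s)} := by
  cases q with
  | zero =>
    convert dense_univ using 1
    exact eq_univ_of_forall fun s x _ => Function.injective_of_subsingleton _
  | succ q =>
    set f : Fin (q + 1) → EuclideanSpace ℝ (Fin (q + 1)) × (Fin q → ℝ) × (Fin q → Fin N → ℝ) →
      EuclideanSpace ℝ (Fin (q + 1)) →L[ℝ] (Fin N → ℝ) := fun a p =>
        Ring.inverse (L p.1) (dependentColumns a p.2.1 p.2.2 - G p.1) with hf
    set Ω : Set (EuclideanSpace ℝ (Fin (q + 1)) × (Fin q → ℝ) × (Fin q → Fin N → ℝ)) :=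
      U ×ˢ univ with hΩ
    have hfs (a) : ContDiffOn ℝ 1 (f a) Ω := by
      have h1 : ContDiffOn ℝ 1 (fun p : EuclideanSpace ℝ (Fin (q + 1)) × (Fin q → ℝ) ×
          (Fin q → Fin N → ℝ) => L p.1) Ω := hL.comp contDiffOn_fst fun p hp => hp.1
      have h2 : ContDiffOn ℝ 1 (fun p : EuclideanSpace ℝ (Fin (q + 1)) × (Fin q → ℝ) ×
          (Fin q → Fin N → ℝ) => G p.1) Ω := hG.comp contDiffOn_fst fun p hp => hp.1
      have h3 : ContDiffOn ℝ 1 (fun p : EuclideanSpace ℝ (Fin (q + 1)) × (Fin q → ℝ) ×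
          (Fin q → Fin N → ℝ) => Ring.inverse (L p.1)) Ω := fun p hp => by
        obtain ⟨u, hu⟩ := hLu p.1 hp.1
        have := contDiffAt_ringInverse (n := 1) ℝ (R := (EuclideanSpace ℝ (Fin (q + 1)) →L[ℝ]
          (Fin N → ℝ)) →L[ℝ] EuclideanSpace ℝ (Fin (q + 1)) →L[ℝ] (Fin N → ℝ)) u
        rw [hu] at this
        exact this.comp_contDiffWithinAt p (h1 p hp)
      exact h3.clm_apply (((contDiff_dependentColumns a).comp contDiff_snd).contDiffOn.sub h2)
    have hbad : {s | ∀ x ∈ U, Function.Injective (G x + L x s)}ᶜ ⊆ ⋃ a, f a '' Ω := by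
      intro s hs
      simp only [mem_compl_iff, mem_ofPred_eq, not_forall] at hs
      obtain ⟨x, hx, hs⟩ := hs
      obtain ⟨a, v, w, h⟩ := exists_eq_dependentColumns hs
      refine mem_iUnion.2 ⟨a, (x, v, w), ⟨hx, mem_univ _⟩, ?_⟩
      simp only [hf]
      rw [← h, add_sub_cancel_left, ← mul_apply_eq_comp, Ring.inverse_mul_cancel _ (hLu x hx)]
      rfl
    have hdim : dimH (⋃ a, f a '' Ω) <
        finrank ℝ (EuclideanSpace ℝ (Fin (q + 1)) →L[ℝ] (Fin N → ℝ)) := by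
      rw [dimH_iUnion]
      refine (iSup_le fun a => ((hfs a).dimH_image_le (hU.prod convex_univ) subset_rfl).trans
        (dimH_mono (subset_univ _))).trans_lt ?_
      rw [Real.dimH_univ_eq_finrank, finrank_continuousLinearMap_euclideanSpace_pi]
      have : q + 1 + (q + q * N) < (q + 1) * N := by nlinarith
      simpa [finrank_pi_fintype] using (mod_cast this)
    refine (dense_compl_of_dimH_lt_finrank hdim).mono ?_
    rwa [← compl_subset_compl, compl_compl]

end Transversality

section LocalDensity

variable {q N : ℕ} {M : Type*} [TopologicalSpace M] [ChartedSpace (EuclideanSpace ℝ (Fin q)) M]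
  [IsManifold (𝓡 q) ∞ M]

/-- If every linear map is the derivative at `m` of some `T obs`, then near `m` the tangent map of
`T obs` is injective for a dense set of `obs`. -/
theorem exists_mem_nhds_dense_injective_mfderiv (hN : 2 * q ≤ N)
    (T : C^2⟮𝓡 q, M; 𝓘(ℝ, ℝ), ℝ⟯ →ₗ[ℝ] C^2⟮𝓡 q, M; 𝓘(ℝ, Fin N → ℝ), Fin N → ℝ⟯) {m : M}
    (hm : ∀ S, ∃ obs, chartDeriv (chartAt (EuclideanSpace ℝ (Fin q)) m) (T obs) m = S) :
    ∃ W ∈ 𝓝 m, Dense {obs : C^2⟮𝓡 q, M; 𝓘(ℝ, ℝ), ℝ⟯ |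
      ∀ x ∈ W, Function.Injective (mfderiv (𝓡 q) 𝓘(ℝ, Fin N → ℝ) (T obs) x)} := by
  set ψ := chartAt (EuclideanSpace ℝ (Fin q)) m with hψ
  have hmψ : m ∈ ψ.source := mem_chart_source _ m
  have hψA : ψ ∈ IsManifold.maximalAtlas (𝓡 q) ∞ M := IsManifold.chart_mem_maximalAtlas m
  choose η hη using hm
  -- perturbations whose derivatives at `m` form a basis; `L x s` is the derivative at `x` of their
  -- combination with coefficients `s`
  let b := Module.finBasis ℝ (EuclideanSpace ℝ (Fin q) →L[ℝ] (Fin N → ℝ))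
  let d (g : C^2⟮𝓡 q, M; 𝓘(ℝ, Fin N → ℝ), Fin N → ℝ⟯) := fderiv ℝ (g ∘ ψ.symm)
  have hd (g) : ContDiffOn ℝ 1 (d g) ψ.target :=
    (g.contDiffOn_comp_symm hψA).fderiv_of_isOpen ψ.open_target (by norm_num)
  let L : EuclideanSpace ℝ (Fin q) → (EuclideanSpace ℝ (Fin q) →L[ℝ] (Fin N → ℝ)) →L[ℝ]
      EuclideanSpace ℝ (Fin q) →L[ℝ] (Fin N → ℝ) := fun x =>
    ∑ k, ContinuousLinearMap.smulRightL ℝ _ _ (LinearMap.toContinuousLinearMap (b.coord k))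
      (d (T (η (b k))) x)
  have hLs : ContDiffOn ℝ 1 L ψ.target :=
    ContDiffOn.sum fun k _ => ContDiff.comp_contDiffOn (ContinuousLinearMap.contDiff _) (hd _)
  have hLm : L (ψ m) = 1 := by
    ext1 s
    have h1 (k) : d (T (η (b k))) (ψ m) = b k := hη (b k)
    simp only [L, h1]
    simp
  have hLu : ∀ᶠ x in 𝓝 (ψ m), x ∈ ψ.target ∧ IsUnit (L x) := by
    refine (ψ.open_target.eventually_mem (ψ.map_source hmψ)).and ?_
    have h1 : ContinuousAt L (ψ m) :=
      hLs.continuousOn.continuousAt (ψ.open_target.mem_nhds (ψ.map_source hmψ))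
    have h2 := Units.nhds (R := (EuclideanSpace ℝ (Fin q) →L[ℝ] (Fin N → ℝ)) →L[ℝ]
      EuclideanSpace ℝ (Fin q) →L[ℝ] (Fin N → ℝ)) 1
    rw [Units.val_one, ← hLm] at h2
    exact h1 h2
  obtain ⟨r, hr0, hr⟩ := Metric.eventually_nhds_iff_ball.1 hLu
  refine ⟨ψ.source ∩ ψ ⁻¹' Metric.ball (ψ m) r, inter_mem (ψ.open_source.mem_nhds hmψ)
    (ψ.continuousAt hmψ (Metric.ball_mem_nhds _ hr0)), ?_⟩
  intro obs
  rw [mem_closure_iff_nhds]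
  intro O hO
  have hdense := dense_setOf_injective_add hN (convex_ball (ψ m) r)
    ((hd (T obs)).mono fun x hx => (hr x hx).1) (hLs.mono fun x hx => (hr x hx).1)
    fun x hx => (hr x hx).2
  have hlim : Tendsto (fun s => obs + ∑ k, b.repr s k • η (b k)) (𝓝 0) (𝓝 obs) := by
    have h1 : Continuous fun s => (⇑(b.repr s) : _ → ℝ) :=
      (b.equivFun.toLinearMap).continuous_of_finiteDimensional
    have h2 : Tendsto (fun s => (⇑(b.repr s) : _ → ℝ)) (𝓝 0) (𝓝 0) := by
      simpa using h1.tendsto 0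
    exact (obs.tendsto_add_sum_smul fun k => η (b k)).comp h2
  obtain ⟨s, hsO, hs⟩ := hdense.inter_nhds_nonempty (hlim hO)
  refine ⟨_, hs, fun x hx => ?_⟩
  rw [mfderiv_injective_iff_chartDeriv (((T _).contMDiff x).mdifferentiableAt two_ne_zero) hx.1]
  convert hsO (ψ x) hx.2 using 2
  change chartDerivLinear hψA hx.1 (T _) = chartDerivLinear hψA hx.1 (T obs) + _
  simp only [map_add, map_sum, map_smul]
  congr 1
  simp [L]
  rfl

end LocalDensity

/-! ### Linear algebra at a periodic point -/

section Algebra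

open TensorProduct Module

variable {E : Type*} [AddCommGroup E] [Module ℝ E] [FiniteDimensional ℝ E]

/-- The complex linear extension of a real functional. -/
noncomputable def complexExtension (l : E →ₗ[ℝ] ℝ) : ℂ ⊗[ℝ] E →ₗ[ℂ] ℂ :=
  (Algebra.linearMap ℝ ℂ ∘ₗ l).liftBaseChange ℂ

/-- Finitely many nonzero complex vectors are avoided by the kernel of some real functional, as a
real vector space is no finite union of hyperplanes. -/
theorem exists_complexExtension_ne_zero {ι : Type*} [Finite ι] (v : ι → ℂ ⊗[ℝ] E)
    (hv : ∀ i, v i ≠ 0) : ∃ l : E →ₗ[ℝ] ℝ, ∀ i, complexExtension l (v i) ≠ 0 := by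
  let b := finBasis ℝ E
  let b' := Algebra.TensorProduct.basis ℂ b
  have hcoord (k) (z) : complexExtension (b.coord k) z = b'.repr z k := by
    have : complexExtension (b.coord k) = b'.coord k := by
      refine TensorProduct.AlgebraTensorModule.ext fun c u => ?_
      simp [complexExtension, b']
    rw [this]
    rfl
  -- a nonzero complex vector has a coordinate with nonzero real or imaginary part
  have h1 (i) : ∃ f : Dual ℝ (Dual ℝ E),
      (∀ l, f l ≠ 0 → complexExtension l (v i) ≠ 0) ∧ ∃ l, f l ≠ 0 := by
    obtain ⟨k, hk⟩ : ∃ k, b'.repr (v i) k ≠ 0 := by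
      by_contra! h
      exact hv i (b'.repr.map_eq_zero_iff.1 (Finsupp.ext h))
    rw [← hcoord] at hk
    let F : Dual ℝ E →ₗ[ℝ] ℂ :=
      { toFun := fun l => complexExtension l (v i)
        map_add' := fun l l' => by simp [complexExtension, LinearMap.comp_add]
        map_smul' := fun c l => by
          have : Algebra.linearMap ℝ ℂ ∘ₗ (c • l) = (c : ℂ) • (Algebra.linearMap ℝ ℂ ∘ₗ l) := by
            ext
            simp
          simp only [complexExtension, this, map_smul, LinearMap.smul_apply, RingHom.id_apply]
          exact Complex.coe_smul _ _ }
    by_cases hre : (complexExtension (b.coord k) (v i)).re = 0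
    · refine ⟨Complex.imLm ∘ₗ F, fun l hl h => hl ?_, b.coord k, fun h => hk (Complex.ext hre h)⟩
      change (complexExtension l (v i)).im = 0
      simp [h]
    · refine ⟨Complex.reLm ∘ₗ F, fun l hl h => hl ?_, b.coord k, fun h => hre h⟩
      change (complexExtension l (v i)).re = 0
      simp [h]
  choose f hf hf' using h1
  obtain ⟨l, hl⟩ := Dual.exists_forall_ne_zero_of_forall_exists f hf'
  exact ⟨l, fun i => hf i l (hl i)⟩

/-- Let `R` have as many distinct complex eigenvalues as its dimension. For a functional `ξ` that
vanishes on no eigenvector, a solution `X` of `X = B X R + w ⊗ ξ` sends the eigenvector with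
eigenvalue `l` to a nonzero multiple of `(1 - l B)⁻¹ w`, and is therefore injective if these vectors
are independent. -/
theorem exists_dual_forall_injective {N : ℕ} (R : End ℝ E)
    (hR : {l : ℂ | End.HasEigenvalue (R.baseChange ℂ) l}.ncard = finrank ℝ E)
    (B : Matrix (Fin N) (Fin N) ℝ) (w : Fin N → ℝ)
    (hB : ∀ l : {l : ℂ | End.HasEigenvalue (R.baseChange ℂ) l},
      IsUnit (1 - (l : ℂ) • toComplexMatrix B))
    (hw : LinearIndependent ℂ fun l : {l : ℂ | End.HasEigenvalue (R.baseChange ℂ) l} =>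
      (1 - (l : ℂ) • toComplexMatrix B)⁻¹.mulVec fun i => (w i : ℂ)) :
    ∃ ξ : E →ₗ[ℝ] ℝ, ∀ X : E →ₗ[ℝ] (Fin N → ℝ), (∀ u, X u = B.mulVec (X (R u)) + ξ u • w) →
      Function.Injective X := by
  set Λ := {l : ℂ | End.HasEigenvalue (R.baseChange ℂ) l} with hΛ
  have hfin : Λ.Finite := End.finite_hasEigenvalue (f := R.baseChange ℂ)
  have : Finite Λ := hfin
  have : Fintype Λ := Fintype.ofFinite _
  have hv (l : Λ) : ∃ v, End.HasEigenvector (R.baseChange ℂ) l v :=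
    End.HasEigenvalue.exists_hasEigenvector l.2
  choose v hv using hv
  obtain ⟨ξ, hξ⟩ := exists_complexExtension_ne_zero v fun l => (hv l).2
  refine ⟨ξ, fun X hX => ?_⟩
  let c : (Fin N → ℝ) →ₗ[ℝ] (Fin N → ℂ) := (Algebra.linearMap ℝ ℂ).compLeft (Fin N)
  have hc (y : Fin N → ℝ) : c (B.mulVec y) = (toComplexMatrix B).mulVec (c y) := by
    ext i
    simp [c, Matrix.mulVec, dotProduct, toComplexMatrix]
  let Xc : ℂ ⊗[ℝ] E →ₗ[ℂ] (Fin N → ℂ) := (c ∘ₗ X).liftBaseChange ℂ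
  have hXc (z) : Xc z = (toComplexMatrix B).mulVec (Xc (R.baseChange ℂ z)) +
      complexExtension ξ z • c w := by
    induction z using TensorProduct.induction_on with
    | zero => simp
    | tmul a u =>
      simp only [Xc, complexExtension, LinearMap.baseChange_tmul, LinearMap.liftBaseChange_tmul,
        LinearMap.comp_apply]
      rw [hX u, map_add, map_smul, hc, smul_add, Matrix.mulVec_smul]
      congr 1
      simp [mul_smul]
    | add y z hy hz =>
      rw [map_add, hy, hz]
      simp only [map_add, Matrix.mulVec_add, add_smul]
      abel
  have hvec (l : Λ) : Xc (v l) = complexExtension ξ (v l) •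
      (1 - (l : ℂ) • toComplexMatrix B)⁻¹.mulVec fun i => (w i : ℂ) := by
    have h1 := hXc (v l)
    rw [(hv l).apply_eq_smul, map_smul, Matrix.mulVec_smul] at h1
    have h2 : (1 - (l : ℂ) • toComplexMatrix B).mulVec (Xc (v l)) =
        complexExtension ξ (v l) • c w := by
      rw [Matrix.sub_mulVec, Matrix.one_mulVec, Matrix.smul_mulVec, sub_eq_iff_eq_add']
      exact h1
    have h3 := congrArg ((1 - (l : ℂ) • toComplexMatrix B)⁻¹.mulVec) h2
    rw [Matrix.mulVec_mulVec, Matrix.nonsing_inv_mul _ ((Matrix.isUnit_iff_isUnit_det _).1 (hB l)),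
      Matrix.one_mulVec, Matrix.mulVec_smul] at h3
    exact h3
  have hli : LinearIndependent ℂ fun l => Xc (v l) := by
    simp only [hvec]
    exact hw.units_smul fun l => Units.mk0 _ (hξ l)
  have hvli : LinearIndependent ℂ v := End.eigenvectors_linearIndependent (R.baseChange ℂ) Λ v hv
  have hcard : Fintype.card Λ = finrank ℂ (ℂ ⊗[ℝ] E) := by
    rw [finrank_baseChange, ← hR, Set.ncard_eq_toFinset_card', Set.toFinset_card]
  have hspan := hvli.span_eq_top_of_card_eq_finrank' hcard
  have hXinj : Function.Injective Xc := by
    rw [injective_iff_map_eq_zero]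
    intro z hz
    obtain ⟨d, rfl⟩ := (Submodule.mem_span_range_iff_exists_fun ℂ).1
      (hspan ▸ Submodule.mem_top (x := z))
    rw [map_sum] at hz
    simp only [map_smul] at hz
    exact Finset.sum_eq_zero fun l _ => by
      rw [Fintype.linearIndependent_iff.1 hli d hz l, zero_smul]
  have h5 : Function.Injective fun u : E => (1 : ℂ) ⊗ₜ[ℝ] u :=
    Module.Flat.tensorProduct_mk_injective ..
  intro u u' huu
  refine h5 (hXinj ?_)
  simp [Xc, huu]

/-- The factor `(1 - A)⁻¹ (1 - A ^ n) C` is the geometric sum of the vectors `A ^ j C`, `j < n`. -/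
theorem resolventVector_eq {N : ℕ} {A : Matrix (Fin N) (Fin N) ℝ}
    (hρ : spectralRadius ℂ (toComplexMatrix A) < 1) (C : Fin N → ℝ) (n : ℕ) (l : ℂ) :
    resolventVector A C n l = (1 - l • toComplexMatrix (A ^ n))⁻¹.mulVec
      fun i => ((∑ j ∈ Finset.range n, (A ^ j).mulVec C) i : ℂ) := by
  have hu : IsUnit (1 - toComplexMatrix A) := by
    simpa using isUnit_one_sub_smul_pow (l := 1) (l' := 1) (k := 1) (n := 1) hρ one_pos le_rfl
      le_rfl (by simpa using hρ)
  have hpow (j : ℕ) : toComplexMatrix (A ^ j) = toComplexMatrix A ^ j := Matrix.map_pow ..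
  have hsum : (1 - toComplexMatrix A)⁻¹ * (1 - toComplexMatrix A ^ n) =
      ∑ j ∈ Finset.range n, toComplexMatrix A ^ j := by
    rw [← mul_neg_geom_sum, ← mul_assoc, Matrix.nonsing_inv_mul _
      ((Matrix.isUnit_iff_isUnit_det _).1 hu), one_mul]
  rw [resolventVector, mul_assoc, hsum, ← Matrix.mulVec_mulVec, hpow]
  congr 1
  rw [Matrix.sum_mulVec]
  ext i
  simp only [← hpow]
  simp [Matrix.mulVec, dotProduct, toComplexMatrix]

theorem finite_setOf_not_injective_add_smul {N : ℕ} (X₀ X₁ : E →ₗ[ℝ] (Fin N → ℝ))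
    (h : Function.Injective X₁) : {t : ℝ | ¬Function.Injective (X₀ + t • X₁)}.Finite := by
  obtain ⟨P, hP⟩ := X₁.exists_leftInverse_of_injective (LinearMap.ker_eq_bot.2 h)
  -- such a `t` is the negative of an eigenvalue of `P ∘ₗ X₀`
  refine ((End.finite_hasEigenvalue (f := P ∘ₗ X₀)).preimage
    neg_injective.injOn).subset fun t ht => ?_
  rw [mem_ofPred_eq, injective_iff_map_eq_zero] at ht
  push Not at ht
  obtain ⟨u, hu, hu0⟩ := ht
  refine End.hasEigenvalue_of_hasEigenvector (x := u) ⟨End.mem_eigenspace_iff.2 ?_, hu0⟩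
  have h1 : X₀ u = -(t • X₁ u) := eq_neg_of_add_eq_zero_left hu
  have h2 : P (X₁ u) = u := LinearMap.congr_fun hP u
  rw [LinearMap.comp_apply, h1, map_neg, map_smul, h2, neg_smul]

end Algebra

/-! ### Periodic points -/

section Periodic

variable {q N : ℕ} {M : Type*} [TopologicalSpace M] [ChartedSpace (EuclideanSpace ℝ (Fin q)) M]
  [IsManifold (𝓡 q) ∞ M]

theorem hasFDerivAt_comp_iterate_symm {V : Type*} [NormedAddCommGroup V] [NormedSpace ℝ V]
    (g : C^2⟮𝓡 q, M; 𝓘(ℝ, V), V⟯) (φ : M ≃ₘ^2⟮𝓡 q, 𝓡 q⟯ M) (i : ℕ) (m : M) :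
    HasFDerivAt (fun z => g (φ.symm^[i] ((chartAt (EuclideanSpace ℝ (Fin q)) m).symm z)))
      (chartDeriv (chartAt (EuclideanSpace ℝ (Fin q)) m) (g ∘ φ.symm^[i]) m)
      (chartAt (EuclideanSpace ℝ (Fin q)) m m) := by
  let h : C^2⟮𝓡 q, M; 𝓘(ℝ, V), V⟯ :=
    ⟨g ∘ φ.symm^[i], g.contMDiff.comp (contMDiff_iterate_symm φ i)⟩
  have hψ := IsManifold.chart_mem_maximalAtlas (I := 𝓡 q) (n := ∞) m
  exact (((h.contDiffOn_comp_symm hψ).contDiffAt ((chartAt _ m).open_target.mem_nhds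
    ((chartAt _ m).map_source (mem_chart_source _ m)))).differentiableAt two_ne_zero).hasFDerivAt

/-- An observation can be chosen, by its linear parts at the distinct points of an orbit segment, so
that all its pullbacks `obs ∘ φ⁻ⁱ`, `i < n`, have the same derivative `ℓ` at `m`. -/
theorem exists_forall_chartDeriv_comp_iterate_symm_eq [T2Space M] (φ : M ≃ₘ^2⟮𝓡 q, 𝓡 q⟯ M)
    {m : M} {n : ℕ} (hinj : ∀ i < n, ∀ j < n, φ.symm^[i] m = φ.symm^[j] m → i = j)
    (ℓ : EuclideanSpace ℝ (Fin q) →L[ℝ] ℝ) :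
    ∃ obs : C^2⟮𝓡 q, M; 𝓘(ℝ, ℝ), ℝ⟯, ∀ i < n,
      chartDeriv (chartAt (EuclideanSpace ℝ (Fin q)) m) (obs ∘ φ.symm^[i]) m = ℓ := by
  set ψ := chartAt (EuclideanSpace ℝ (Fin q)) m with hψ
  have hψm : ψ.symm (ψ m) = m := ψ.left_inv (mem_chart_source _ m)
  choose ξ hξ using fun i => exists_comp_chartDeriv_eq φ i m ℓ
  have hb (k : ℕ) : ∃ b : SmoothBumpFunction (𝓡 q) (φ.symm^[k] m),
      ∀ i < n, φ.symm^[i] m ≠ φ.symm^[k] m → φ.symm^[i] m ∉ tsupport b := by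
    have hfin : ((fun i => φ.symm^[i] m) '' Iio n \ {φ.symm^[k] m}).Finite :=
      ((finite_Iio n).image _).sdiff
    obtain ⟨b, -, hb⟩ := (SmoothBumpFunction.nhds_basis_tsupport (I := 𝓡 q)
      (φ.symm^[k] m)).mem_iff.1 (hfin.isClosed.isOpen_compl.mem_nhds fun h => h.2 rfl)
    exact ⟨b, fun i hi hik hib => hb hib ⟨⟨i, hi, rfl⟩, hik⟩⟩
  choose b hb using hb
  have hcont (j : ℕ) : ContinuousAt (fun z => φ.symm^[j] (ψ.symm z)) (ψ m) :=
    (contMDiff_iterate_symm φ j).continuous.continuousAt.comp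
      (ψ.continuousAt_symm (ψ.map_source (mem_chart_source _ m)))
  have hd : ∀ i < n, ∀ k < n, HasFDerivAt
      (fun z => linearBump (b k) (ξ k) (φ.symm^[i] (ψ.symm z))) (if k = i then ℓ else 0) (ψ m) := by
    intro i hi k hk
    split_ifs with hki
    · subst hki
      have h1 : ∀ᶠ z in 𝓝 (ψ m), b k (φ.symm^[k] (ψ.symm z)) = 1 := by
        refine (hcont k).eventually (p := fun y => b k y = 1) ?_
        change ∀ᶠ y in 𝓝 (φ.symm^[k] (ψ.symm (ψ m))), b k y = 1
        rw [hψm]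
        exact (b k).eventuallyEq_one
      rw [← hξ k]
      refine HasFDerivAt.congr_of_eventuallyEq (((ξ k).hasFDerivAt).comp (ψ m)
        ((hasFDerivAt_chart_comp_iterate_symm φ k m).sub_const
          (chartAt (EuclideanSpace ℝ (Fin q)) (φ.symm^[k] m) (φ.symm^[k] m)))) ?_
      filter_upwards [h1] with z hz
      rw [linearBump_apply, hz, one_mul]
      rfl
    · have h1 : ∀ᶠ z in 𝓝 (ψ m), b k (φ.symm^[i] (ψ.symm z)) = 0 := by
        refine (hcont i).eventually (p := fun y => b k y = 0) ?_
        change ∀ᶠ y in 𝓝 (φ.symm^[i] (ψ.symm (ψ m))), b k y = 0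
        rw [hψm]
        exact notMem_tsupport_iff_eventuallyEq.1
          (hb k i hi fun h => hki (hinj i hi k hk h).symm)
      refine HasFDerivAt.congr_of_eventuallyEq (hasFDerivAt_const (0 : ℝ) _) ?_
      filter_upwards [h1] with z hz
      rw [linearBump_apply, hz, zero_mul]
  refine ⟨∑ k ∈ Finset.range n, linearBump (b k) (ξ k), fun i hi => ?_⟩
  have h1 := HasFDerivAt.fun_sum fun k hk => hd i hi k (Finset.mem_range.1 hk)
  rw [Finset.sum_ite_eq' (Finset.range n) i, if_pos (Finset.mem_range.2 hi)] at h1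
  have h2 : (fun z => ∑ k ∈ Finset.range n, linearBump (b k) (ξ k) (φ.symm^[i] (ψ.symm z))) =
      (⇑(∑ k ∈ Finset.range n, linearBump (b k) (ξ k)) ∘ φ.symm^[i]) ∘ ψ.symm := by
    funext z
    exact (map_sum ((Pi.evalAddMonoidHom (fun _ => ℝ) (φ.symm^[i] (ψ.symm z))).comp
      (ContMDiffMap.coeFnAddMonoidHom (I := 𝓡 q) (I' := 𝓘(ℝ, ℝ)) (N := M) (n := 2)
        (G := ℝ))) (fun k => linearBump (b k) (ξ k)) (Finset.range n)).symm
  rw [h2] at h1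
  exact h1.fderiv

/-- At a periodic point of period `n`, the derivative `X` of the synchronization satisfies
`X = A ^ n X (T_m φ⁻ⁿ) + ∑ i < n, A ^ i C ⊗ D (obs ∘ φ⁻ⁱ)`. -/
theorem chartDeriv_apply_of_iterate_symm_eq {φ : M ≃ₘ^2⟮𝓡 q, 𝓡 q⟯ M}
    {A : Matrix (Fin N) (Fin N) ℝ} {C : Fin N → ℝ} {obs : C^2⟮𝓡 q, M; 𝓘(ℝ, ℝ), ℝ⟯}
    {f : C^2⟮𝓡 q, M; 𝓘(ℝ, Fin N → ℝ), Fin N → ℝ⟯}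
    (hf : IsGeneralizedSynchronization φ.toEquiv obs (linearStateMap A C) f) {m : M}
    (hm : φ.symm^[Function.minimalPeriod φ m] m = m) (u : EuclideanSpace ℝ (Fin q)) :
    chartDeriv (chartAt (EuclideanSpace ℝ (Fin q)) m) f m u =
      (A ^ Function.minimalPeriod φ m).mulVec
        (chartDeriv (chartAt (EuclideanSpace ℝ (Fin q)) m) f m (returnDerivative φ m u)) +
      ∑ i ∈ Finset.range (Function.minimalPeriod φ m),
        chartDeriv (chartAt (EuclideanSpace ℝ (Fin q)) m) (obs ∘ φ.symm^[i]) m u •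
          (A ^ i).mulVec C := by
  set ψ := chartAt (EuclideanSpace ℝ (Fin q)) m with hψ
  set n := Function.minimalPeriod φ m with hn
  have hfd (x : M) : MDifferentiableAt (𝓡 q) 𝓘(ℝ, Fin N → ℝ) f x :=
    (f.contMDiff x).mdifferentiableAt two_ne_zero
  have hφd : MDifferentiableAt (𝓡 q) (𝓡 q) (φ.symm^[n]) m :=
    (contMDiff_iterate_symm φ n).mdifferentiable two_ne_zero m
  have h1 : chartDeriv ψ (f ∘ φ.symm^[n]) m u = chartDeriv ψ f m (returnDerivative φ m u) := by
    let Df (x : M) : EuclideanSpace ℝ (Fin q) →L[ℝ] (Fin N → ℝ) :=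
      mfderiv (𝓡 q) 𝓘(ℝ, Fin N → ℝ) f x
    have h2 : (chartDeriv ψ (f ∘ φ.symm^[n]) m) u = Df (φ.symm^[n] m) (returnDerivative φ m u) := by
      rw [hψ, chartDeriv_eq_mfderiv _ _ ((hfd _).comp m hφd), mfderiv_comp m (hfd _) hφd]
      rfl
    rw [h2, hm, hψ, chartDeriv_eq_mfderiv _ _ (hfd m)]
  have h3 : HasFDerivAt (fun z => ∑ i ∈ Finset.range n,
      obs (φ.symm^[i] (ψ.symm z)) • (A ^ i).mulVec C + (A ^ n).mulVec (f (φ.symm^[n] (ψ.symm z))))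
      (∑ i ∈ Finset.range n, (chartDeriv ψ (obs ∘ φ.symm^[i]) m).smulRight ((A ^ i).mulVec C) +
        (LinearMap.toContinuousLinearMap (A ^ n).mulVecLin).comp (chartDeriv ψ (f ∘ φ.symm^[n]) m))
      (ψ m) := by
    refine HasFDerivAt.add (HasFDerivAt.fun_sum fun i _ => ?_) ?_
    · exact (hasFDerivAt_comp_iterate_symm obs φ i m).smul_const _
    · exact (LinearMap.toContinuousLinearMap (A ^ n).mulVecLin).hasFDerivAt.comp (ψ m)
        (hasFDerivAt_comp_iterate_symm f φ n m)
  have h4 : f ∘ ψ.symm = fun z => ∑ i ∈ Finset.range n,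
      obs (φ.symm^[i] (ψ.symm z)) • (A ^ i).mulVec C +
        (A ^ n).mulVec (f (φ.symm^[n] (ψ.symm z))) :=
    funext fun z => hf.apply_eq_sum n (ψ.symm z)
  rw [← h4] at h3
  have hX : chartDeriv ψ f m = _ := h3.fderiv
  rw [← h1]
  refine (DFunLike.congr_fun hX u).trans ?_
  simp [add_comm]

/-- Some observation `η` gives an injective derivative at `m`, and then so does `obs + t • η` for
all but finitely many `t`. -/
theorem dense_setOf_injective_mfderiv_of_mem_periodicPts [T2Space M] {φ : M ≃ₘ^2⟮𝓡 q, 𝓡 q⟯ M}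
    {A : Matrix (Fin N) (Fin N) ℝ} {C : Fin N → ℝ}
    {T : C^2⟮𝓡 q, M; 𝓘(ℝ, ℝ), ℝ⟯ →ₗ[ℝ] C^2⟮𝓡 q, M; 𝓘(ℝ, Fin N → ℝ), Fin N → ℝ⟯}
    (hρ : spectralRadius ℂ (toComplexMatrix A) < 1)
    (hT : ∀ obs : C^2⟮𝓡 q, M; 𝓘(ℝ, ℝ), ℝ⟯,
      IsGeneralizedSynchronization φ.toEquiv obs (linearStateMap A C) (T obs))
    {m : M} (hm : m ∈ Function.periodicPts φ)
    (h_distinct : (returnEigenvalues φ m).ncard = q)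
    (h_unit : ∀ l ∈ returnEigenvalues φ m,
      IsUnit (1 - l • toComplexMatrix A ^ Function.minimalPeriod φ m))
    (h_indep : LinearIndependent ℂ
      (fun l : returnEigenvalues φ m => resolventVector A C (Function.minimalPeriod φ m) l)) :
    Dense {obs : C^2⟮𝓡 q, M; 𝓘(ℝ, ℝ), ℝ⟯ |
      Function.Injective (mfderiv (𝓡 q) 𝓘(ℝ, Fin N → ℝ) (T obs) m)} := by
  set n := Function.minimalPeriod φ m with hn
  have hn0 : 0 < n := Function.minimalPeriod_pos_of_mem_periodicPts hm
  have hdist : ∀ i < n, ∀ j < n, φ.symm^[i] m = φ.symm^[j] m → i = j := by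
    have key : ∀ i j : ℕ, i < j → j < n → φ.symm^[i] m ≠ φ.symm^[j] m := by
      intro i j hij hj h
      have := (isPeriodicPt_of_iterate_symm_eq (φ := φ.toEquiv) hij h).minimalPeriod_le
        (Nat.sub_pos_of_lt hij)
      have : n ≤ j - i := this
      omega
    intro i hi j hj h
    by_contra hne
    rcases Nat.lt_or_gt_of_ne hne with h' | h'
    · exact key i j h' hj h
    · exact key j i h' hi h.symm
  have hret : φ.symm^[n] m = m := by
    have h1 := φ.toEquiv.leftInverse_symm.iterate n m
    have h2 : φ^[n] m = m := Function.iterate_minimalPeriod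
    have h3 : φ.symm^[n] (φ^[n] m) = m := h1
    rwa [h2] at h3
  have hpow : toComplexMatrix (A ^ n) = toComplexMatrix A ^ n := Matrix.map_pow ..
  -- a covector on which the prescribed data make the derivative injective
  obtain ⟨ξ, hξ⟩ : ∃ ξ : EuclideanSpace ℝ (Fin q) →ₗ[ℝ] ℝ,
      ∀ X : EuclideanSpace ℝ (Fin q) →ₗ[ℝ] (Fin N → ℝ),
        (∀ u, X u = (A ^ n).mulVec (X (returnDerivative φ m u)) +
          ξ u • ∑ j ∈ Finset.range n, (A ^ j).mulVec C) → Function.Injective X := by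
    have : FiniteDimensional ℝ (TangentSpace (𝓡 q) m) :=
      inferInstanceAs (FiniteDimensional ℝ (EuclideanSpace ℝ (Fin q)))
    have hq : q = Module.finrank ℝ (TangentSpace (𝓡 q) m) :=
      (finrank_euclideanSpace_fin (𝕜 := ℝ)).symm
    refine exists_dual_forall_injective (E := TangentSpace (𝓡 q) m) (returnDerivative φ m)
      (h_distinct.trans hq) (A ^ n) _ (fun l => ?_) ?_
    · rw [hpow]
      exact h_unit l l.2
    · simp only [resolventVector_eq hρ] at h_indep
      exact h_indep
  obtain ⟨η, hη⟩ := exists_forall_chartDeriv_comp_iterate_symm_eq φ hdist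
    (LinearMap.toContinuousLinearMap ξ)
  have hXη : Function.Injective (chartDeriv (chartAt (EuclideanSpace ℝ (Fin q)) m) (T η) m) := by
    refine hξ (chartDeriv (chartAt (EuclideanSpace ℝ (Fin q)) m) (T η) m).toLinearMap fun u => ?_
    refine (chartDeriv_apply_of_iterate_symm_eq (hT η) hret u).trans ?_
    congr 1
    rw [Finset.smul_sum]
    exact Finset.sum_congr rfl fun i hi => by rw [hη i (Finset.mem_range.1 hi)]; rfl
  intro obs
  rw [mem_closure_iff_nhds]
  intro O hO
  have hlim : Tendsto (fun t : ℝ => obs + t • η) (𝓝 0) (𝓝 obs) := by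
    have : ContinuousAdd C^2⟮𝓡 q, M; 𝓘(ℝ, ℝ), ℝ⟯ := ContMDiffMap.instContinuousAdd (n := 2)
    have : Continuous fun t : ℝ => obs + t • η :=
      continuous_const.add (ContMDiffMap.continuous_smul_const (n := 2) η)
    simpa using this.tendsto 0
  have hmA := IsManifold.chart_mem_maximalAtlas (I := 𝓡 q) (n := ∞) m
  have hms := mem_chart_source (EuclideanSpace ℝ (Fin q)) m
  have hfin := finite_setOf_not_injective_add_smul
    (chartDeriv (chartAt (EuclideanSpace ℝ (Fin q)) m) (T obs) m).toLinearMap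
    (chartDeriv (chartAt (EuclideanSpace ℝ (Fin q)) m) (T η) m).toLinearMap hXη
  obtain ⟨t, htO, ht⟩ : (((fun t : ℝ => obs + t • η) ⁻¹' O) \ _).Nonempty :=
    ((infinite_of_mem_nhds (0 : ℝ) (hlim hO)).sdiff hfin).nonempty
  refine ⟨obs + t • η, htO, ?_⟩
  rw [mem_ofPred_eq, mfderiv_injective_iff_chartDeriv
    (((T _).contMDiff m).mdifferentiableAt two_ne_zero) hms]
  have hlin : chartDeriv (chartAt (EuclideanSpace ℝ (Fin q)) m) (T (obs + t • η)) m =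
      chartDeriv (chartAt (EuclideanSpace ℝ (Fin q)) m) (T obs) m +
        t • chartDeriv (chartAt (EuclideanSpace ℝ (Fin q)) m) (T η) m := by
    change chartDerivLinear hmA hms (T _) = chartDerivLinear hmA hms (T obs) +
      t • chartDerivLinear hmA hms (T η)
    simp only [map_add, map_smul]
  rw [hlin]
  by_contra h
  exact ht h

end Periodic

/-! ### Density from local density -/

section Density

variable {X Y : Type*} [TopologicalSpace X] [TopologicalSpace Y] {D : X → Y → Prop}

theorem dense_setOf_forall_mem_of_finite
    (hopen : ∀ K, IsCompact K → IsOpen {g | ∀ x ∈ K, D g x}) {P : Set Y} (hP : P.Finite)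
    (hd : ∀ x ∈ P, Dense {g | D g x}) : Dense {g | ∀ x ∈ P, D g x} := by
  induction P, hP using Set.Finite.induction_on with
  | empty => simp
  | @insert a s _ _ ih =>
    have h1 : IsOpen {g | D g a} := by simpa using hopen {a} isCompact_singleton
    refine ((hd a (mem_insert a s)).inter_of_isOpen_left
      (ih fun x hx => hd x (mem_insert_of_mem a hx)) h1).mono fun g hg => ?_
    rintro x (rfl | hx)
    exacts [hg.1, hg.2 x hx]

theorem dense_setOf_forall_mem_of_isCompact [LocallyCompactSpace Y]
    (hopen : ∀ K, IsCompact K → IsOpen {g | ∀ x ∈ K, D g x}) {S : Set Y} (hS : IsCompact S)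
    (hd : ∀ x ∈ S, ∃ W ∈ 𝓝 x, Dense {g | ∀ y ∈ W, D g y}) : Dense {g | ∀ x ∈ S, D g x} := by
  suffices h : ∃ K, S ⊆ K ∧ IsCompact K ∧ Dense {g | ∀ x ∈ K, D g x} by
    obtain ⟨K, hSK, -, hK⟩ := h
    exact hK.mono fun g (hg : ∀ x ∈ K, D g x) x hx => hg x (hSK hx)
  refine hS.induction_on (p := fun s => ∃ K, s ⊆ K ∧ IsCompact K ∧ Dense {g | ∀ x ∈ K, D g x})
    ⟨∅, Subset.rfl, isCompact_empty, by simp⟩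
    (fun s t hst ⟨K, hK, h⟩ => ⟨K, hst.trans hK, h⟩) ?_ fun x hx => ?_
  · rintro s t ⟨K, hsK, hK, hKd⟩ ⟨L, htL, hL, hLd⟩
    refine ⟨K ∪ L, union_subset_union hsK htL, hK.union hL,
      (hKd.inter_of_isOpen_left hLd (hopen K hK)).mono fun g hg => ?_⟩
    rintro x (hx | hx)
    exacts [hg.1 x hx, hg.2 x hx]
  · obtain ⟨W, hW, hWd⟩ := hd x hx
    obtain ⟨K, hK, hKW, hKc⟩ := local_compact_nhds hW
    exact ⟨K, mem_nhdsWithin_of_mem_nhds hK, K, Subset.rfl, hKc,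
      hWd.mono fun g (hg : ∀ y ∈ W, D g y) y hy => hg y (hKW hy)⟩

/-- Let `D g x` be an open condition in `g` over compact sets of points `x`, and in `x`. If it can
be achieved densely near every point outside a finite set `P`, and densely at each point of `P`, then
it holds at all points for a dense set of `g`: a `g` that is good on `P` is good on a neighbourhood
of `P`, stays so under small changes, and the complement of that neighbourhood is compact. -/
theorem dense_setOf_forall_of_finite_exceptions [CompactSpace Y] [T2Space Y]
    (hopen : ∀ K, IsCompact K → IsOpen {g | ∀ x ∈ K, D g x})
    (hloc : ∀ g x, D g x → ∀ᶠ y in 𝓝 x, D g y) {P : Set Y} (hP : P.Finite)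
    (hdP : ∀ x ∈ P, Dense {g | D g x})
    (hd : ∀ x ∉ P, ∃ W ∈ 𝓝 x, Dense {g | ∀ y ∈ W, D g y}) : Dense {g | ∀ x, D g x} := by
  refine dense_iff_inter_open.2 fun O hO hOne => ?_
  obtain ⟨g, hgO, hg⟩ :=
    (dense_setOf_forall_mem_of_finite hopen hP hdP).inter_open_nonempty O hO hOne
  have hU : IsOpen {x | ∀ᶠ y in 𝓝 x, D g y} := isOpen_setOfPred_eventually_nhds
  obtain ⟨K, hKc, hPK, hKU⟩ := exists_compact_between hP.isCompact hU
    fun x hx => hloc g x (hg x hx)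
  have hdense : Dense {g | ∀ x ∈ (interior K)ᶜ, D g x} :=
    dense_setOf_forall_mem_of_isCompact hopen isOpen_interior.isClosed_compl.isCompact
      fun x hx => hd x fun hxP => hx (hPK hxP)
  obtain ⟨g', hg'O, hg'⟩ := hdense.inter_open_nonempty (O ∩ {g | ∀ x ∈ K, D g x})
    (hO.inter (hopen K hKc)) ⟨g, hgO, fun x hx => (hKU hx).self_of_nhds⟩
  exact ⟨g', hg'O.1, fun x => by_contra fun hx =>
    hx (hg' x fun hxK => hx (hg'O.2 x (interior_subset hxK)))⟩

end Density

/-! ### Finitely many periodic orbits -/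

theorem Function.finite_periodicPts_of_finite_periodicOrbit {α : Type*} {f : α → α}
    (h : (Function.periodicOrbit f '' Function.periodicPts f).Finite) :
    (Function.periodicPts f).Finite := by
  refine (h.biUnion (t := fun c => {x | x ∈ c}) fun c _ => ?_).subset fun x hx =>
    mem_biUnion (mem_image_of_mem _ hx) (Function.self_mem_periodicOrbit hx)
  induction c using Quot.inductionOn with
  | h l => exact List.finite_toSet l

/-- The spectral bound at the largest eigenvalue and the smallest period makes the matrices
`1 - l A ^ n` invertible at all periodic points, so that the inverse in `resolventVector` is a
genuine one. -/
theorem isUnit_one_sub_smul_pow_minimalPeriod {q N : ℕ} {M : Type*} [TopologicalSpace M]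
    [ChartedSpace (EuclideanSpace ℝ (Fin q)) M] {φ : M ≃ₘ^2⟮𝓡 q, 𝓡 q⟯ M}
    {A : Matrix (Fin N) (Fin N) ℝ} (hρ : spectralRadius ℂ (toComplexMatrix A) < 1)
    (hfin : (Function.periodicPts φ).Finite)
    (h_max : ∀ (lmax : ℂ) (nmin : ℕ),
      (∃ m ∈ Function.periodicPts φ, lmax ∈ returnEigenvalues φ m) →
      (∀ m ∈ Function.periodicPts φ, ∀ l ∈ returnEigenvalues φ m, ‖l‖ ≤ ‖lmax‖) →
      IsLeast (Function.minimalPeriod φ '' Function.periodicPts φ) nmin →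
      spectralRadius ℂ (lmax • toComplexMatrix A ^ nmin) < 1)
    {m : M} (hm : m ∈ Function.periodicPts φ) {l : ℂ} (hl : l ∈ returnEigenvalues φ m) :
    IsUnit (1 - l • toComplexMatrix A ^ Function.minimalPeriod φ m) := by
  have hE (x : M) : (returnEigenvalues φ x).Finite :=
    have : FiniteDimensional ℝ (TangentSpace (𝓡 q) x) :=
      inferInstanceAs (FiniteDimensional ℝ (EuclideanSpace ℝ (Fin q)))
    Module.End.finite_hasEigenvalue (f := LinearMap.baseChange ℂ (returnDerivative φ x))
  obtain ⟨lmax, hlmax, hle⟩ := exists_max_image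
    (⋃ x ∈ Function.periodicPts φ, returnEigenvalues φ x) (‖·‖)
    (hfin.biUnion fun x _ => hE x) ⟨l, mem_biUnion hm hl⟩
  have hne : (Function.minimalPeriod φ '' Function.periodicPts φ).Nonempty := ⟨_, m, hm, rfl⟩
  have hleast : IsLeast (Function.minimalPeriod φ '' Function.periodicPts φ) (sInf _) :=
    ⟨Nat.sInf_mem hne, fun _ => Nat.sInf_le⟩
  obtain ⟨x, hx, hxn⟩ := hleast.1
  refine isUnit_one_sub_smul_pow hρ (hxn ▸ Function.minimalPeriod_pos_of_mem_periodicPts hx)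
    (hleast.2 ⟨m, hm, rfl⟩) (hle l (mem_biUnion hm hl)) (h_max lmax _ ?_ ?_ hleast)
  · simpa using hlmax
  · exact fun y hy l hl => hle l (mem_biUnion hy hl)

end Auxiliary

theorem mainTheorem3 {q N : ℕ} {M : Type*} [TopologicalSpace M]
    [ChartedSpace (EuclideanSpace ℝ (Fin q)) M] [IsManifold (𝓡 q) ∞ M]
    [T2Space M] [SecondCountableTopology M] [CompactSpace M] [ConnectedSpace M]
    (φ : M ≃ₘ^2⟮𝓡 q, 𝓡 q⟯ M)
    -- `φ` has finitely many periodic orbits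
    (hfin : (Function.periodicOrbit φ '' Function.periodicPts φ).Finite)
    (A : Matrix (Fin N) (Fin N) ℝ) (C : Fin N → ℝ) (hN : 2 * q ≤ N)
    (hρ : spectralRadius ℂ (toComplexMatrix A) < 1)
    -- every `obs` of class `C²` has a generalized synchronization `Θ obs` of class `C²`, and `Θ` is
    -- continuous for the `C²` topologies
    (Θ : C^2⟮𝓡 q, M; 𝓘(ℝ, ℝ), ℝ⟯ → C^2⟮𝓡 q, M; 𝓘(ℝ, Fin N → ℝ), Fin N → ℝ⟯)
    (hΘ : ∀ obs : C^2⟮𝓡 q, M; 𝓘(ℝ, ℝ), ℝ⟯,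
      IsGeneralizedSynchronization φ.toEquiv obs (linearStateMap A C) (Θ obs))
    (hΘ_cont : Continuous Θ)
    -- at each periodic point `m`, of period `n`, there are `q` distinct eigenvalues of `T_m φ⁻ⁿ`
    (h_distinct : ∀ m ∈ Function.periodicPts φ, (returnEigenvalues φ m).ncard = q)
    -- `ρ (lmax • A ^ nmin) < 1`
    (h_max : ∀ (lmax : ℂ) (nmin : ℕ),
      (∃ m ∈ Function.periodicPts φ, lmax ∈ returnEigenvalues φ m) →
      (∀ m ∈ Function.periodicPts φ, ∀ l ∈ returnEigenvalues φ m, ‖l‖ ≤ ‖lmax‖) →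
      IsLeast (Function.minimalPeriod φ '' Function.periodicPts φ) nmin →
      spectralRadius ℂ (lmax • toComplexMatrix A ^ nmin) < 1)
    (h_indep : ∀ m ∈ Function.periodicPts φ, LinearIndependent ℂ
      (fun l : returnEigenvalues φ m => resolventVector A C (Function.minimalPeriod φ m) l))
    (h_krylov : LinearIndependent ℝ (fun j : Fin N => (A ^ (j : ℕ)).mulVec C)) :
    IsOpen {obs : C^2⟮𝓡 q, M; 𝓘(ℝ, ℝ), ℝ⟯ | IsImmersive (q := q) (Θ obs)} ∧
      Dense {obs : C^2⟮𝓡 q, M; 𝓘(ℝ, ℝ), ℝ⟯ | IsImmersive (q := q) (Θ obs)} := by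
  obtain ⟨T, rfl⟩ := exists_linearMap_eq_of_isGeneralizedSynchronization Θ hΘ
  have hopen (K : Set M) (hK : IsCompact K) :
      IsOpen {obs | ∀ x ∈ K, Function.Injective (mfderiv (𝓡 q) 𝓘(ℝ, Fin N → ℝ) (T obs) x)} :=
    (ContMDiffMap.isOpen_setOf_injective_on hK).preimage hΘ_cont
  have hP := Function.finite_periodicPts_of_finite_periodicOrbit hfin
  refine ⟨by simpa [IsImmersive] using hopen Set.univ isCompact_univ,
    dense_setOf_forall_of_finite_exceptions hopen (fun obs x hx => ?_) hP (fun m hm => ?_)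
      fun m hm => ?_⟩
  · exact ((Continuous.prodMk_right (T obs)).tendsto x).eventually
      ((T obs).eventually_mfderiv_injective hx)
  · exact dense_setOf_injective_mfderiv_of_mem_periodicPts hρ hΘ hm (h_distinct m hm)
      (fun l hl => isUnit_one_sub_smul_pow_minimalPeriod hρ hP h_max hm hl) (h_indep m hm)
  · exact exists_mem_nhds_dense_injective_mfderiv hN T
      fun S => exists_chartDeriv_eq hρ hΘ hΘ_cont h_krylov hm S
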